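/- Let $d\in\mathbb N$ and $\beta>0$. Let $A_j,A_j^*$ ($j\in\mathbb Z^d$) be the annihilation and creation operators satisfying $[A_j,A_j^*]=1$, $[A_j,A_k]=[A_j,A_k^*]=0$ for $j\ne k$, in the occupation number (Fock) representation, let $N_j=A_j^*A_j$, and let $\mathcal D$ be the algebra of all polynomials in finitely many of the $A_j,A_j^*$. For finite $\Lambda\subset\mathbb Z^d$ let $\rho_\Lambda=\prod_{j\in\Lambda}Z^{-1}e^{-\beta N_j}$ with $Z=\sum_{k\ge 0}e^{-\beta k}$, and for $f\in\mathcal D$ put $$\omega_0(f)=\lim_{\Lambda\to\mathbb Z^d}\operatorname{Tr}_\Lambda(\rho_\Lambda f),\qquad \|f\|_{2,\omega_0}^2=\lim_{\Lambda\to\mathbb Z^d}\operatorname{Tr}_\Lambda\bigl|\rho_\Lambda^{1/4}f\rho_\Lambda^{1/4}\bigr|^2 .$$ For $X\in\mathcal D$ let $\delta_X(f)=i[X,f]$. For finite disjoint sets $I,J\subset\mathbb Z^d$ with $|I|=|J|$ let $$A(I,J)=\prod_{i\in I}A_i\prod_{j\in J}A_j^*,\qquad \mathcal E_{I,J}(f)=\sum_{k\in\mathbb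 Z^d}\|\delta_{A(I+k,J+k)}f\|_{2,\omega_0}^2\qquad(f\in\mathcal D).$$ **Theorem.** For every $f\in\mathcal D$ the traces $\operatorname{Tr}_\Lambda(\rho_\Lambda f)$ converge absolutely, the two limits above exist, and $\|f\|_{2,\omega_0}$ and $\mathcal E_{I,J}(f)$ are finite. The operator $A(I,J)$ is invariant under the modular dynamics of $\omega_0$: for every finite $\Lambda\supseteq I\cup J$ and every $t\in\mathbb C$ (in particular every real $t$), $\rho_\Lambda^{it}A(I,J)\rho_\Lambda^{-it}=A(I,J)$. The form $\mathcal E_{I,J}$ does not satisfy the Poincaré inequality: there is no constant $m>0$ such that $$m\,\|f-\omega_0(f)\|_{2,\omega_0}^2\le\mathcal E_{I,J}(f)\qquad\text{for all } f\in\mathcal D .$$ -/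

import Mathlib

open Filter Topology
open scoped ENNReal

noncomputable section

namespace LatticeBosons

/-- Sites of the lattice `ℤ^d`. -/
abbrev Site (d : ℕ) : Type := Fin d → ℤ

/-- Occupation numbers: finitely many particles distributed over the lattice. -/
abbrev Occ (d : ℕ) : Type := Site d →₀ ℕ

/-- Finite linear combinations of the orthonormal occupation number vectors `e_n`. This is the dense
common invariant domain, in the Hilbert space of the lattice, of the creation and annihilation
operators. The vectors `e_n` with `n` supported in `Λ` form an orthonormal basis of `H_Λ`. -/
abbrev Fock (d : ℕ) : Type := Occ d →₀ ℂ

/-- (Unbounded) linear operators on the common invariant domain. -/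
abbrev Op (d : ℕ) : Type := Module.End ℂ (Fock d)

variable {d : ℕ}

/-- The occupation number vector `e_n`. -/
def basisVec (n : Occ d) : Fock d := Finsupp.single n 1

/-- The annihilation operator `A_j`: `A_j e_n = √(n_j) e_{n - 1_j}`. -/
def ann (j : Site d) : Op d :=
  Finsupp.linearCombination ℂ
    (fun n : Occ d => (Real.sqrt (n j) : ℂ) • basisVec (n - Finsupp.single j 1))

/-- The creation operator `A_j^*`: `A_j^* e_n = √(n_j + 1) e_{n + 1_j}`. -/
def cre (j : Site d) : Op d :=
  Finsupp.linearCombination ℂ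
    (fun n : Occ d => (Real.sqrt ((n j : ℝ) + 1) : ℂ) • basisVec (n + Finsupp.single j 1))

/-- The matrix element `⟨e_m, f e_n⟩`. -/
def matElem (f : Op d) (m n : Occ d) : ℂ := f (basisVec n) m

theorem ann_basisVec (j : Site d) (n : Occ d) :
    ann j (basisVec n) = (Real.sqrt (n j) : ℂ) • basisVec (n - Finsupp.single j 1) := by
  simp [ann, basisVec, Finsupp.linearCombination_single]

theorem cre_basisVec (j : Site d) (n : Occ d) :
    cre j (basisVec n) =
      (Real.sqrt ((n j : ℝ) + 1) : ℂ) • basisVec (n + Finsupp.single j 1) := by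
  simp [cre, basisVec, Finsupp.linearCombination_single]

theorem op_ext {f g : Op d} (h : ∀ n, f (basisVec n) = g (basisVec n)) : f = g := by
  apply Finsupp.lhom_ext'
  intro n
  apply LinearMap.ext_ring
  exact h n

theorem ann_commute (i j : Site d) : Commute (ann i) (ann j) := by
  by_cases hij : i = j
  · rw [hij]
  · apply op_ext
    intro n
    have h1 : (n - Finsupp.single j 1 : Occ d) i = n i := by
      simp [Ne.symm hij]
    have h2 : (n - Finsupp.single i 1 : Occ d) j = n j := by
      simp [hij]
    simp only [Module.End.mul_apply, ann_basisVec, map_smul, smul_smul, h1, h2]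
    rw [mul_comm, tsub_right_comm]

theorem cre_commute (i j : Site d) : Commute (cre i) (cre j) := by
  by_cases hij : i = j
  · rw [hij]
  · apply op_ext
    intro n
    have h1 : (n + Finsupp.single j 1 : Occ d) i = n i := by
      simp [Ne.symm hij]
    have h2 : (n + Finsupp.single i 1 : Occ d) j = n j := by
      simp [hij]
    simp only [Module.End.mul_apply, cre_basisVec, map_smul, smul_smul, h1, h2]
    rw [mul_comm, add_right_comm]

/-- `A(I,J) = ∏_{i ∈ I} A_i ∏_{j ∈ J} A_j^*`. -/
def opA (I J : Finset (Site d)) : Op d :=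
  I.noncommProd ann (fun i _ j _ _ => ann_commute i j) *
    J.noncommProd cre (fun i _ j _ _ => cre_commute i j)

/-- The translate `I + k`. -/
def shift (I : Finset (Site d)) (k : Site d) : Finset (Site d) :=
  I.map (addRightEmbedding k)

/-- The algebra `𝒟` of polynomials in the creation and annihilation operators. -/
def polyAlg (d : ℕ) : Subalgebra ℂ (Op d) :=
  Algebra.adjoin ℂ (Set.range ann ∪ Set.range cre)

/-- The derivation `δ_X(B) = i [X, B]`. -/
def innerDer (X B : Op d) : Op d := Complex.I • (X * B - B * X)

/-- The one-site partition function `Z = Tr e^{-β N_j}`. -/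
def partFn (β : ℝ) : ℝ := ∑' k : ℕ, Real.exp (-β * k)

/-- The eigenvalue of the density `ρ_Λ = ∏_{j ∈ Λ} Z⁻¹ e^{-β N_j}` on `e_n`. -/
def gibbsWeight (β : ℝ) (Λ : Finset (Site d)) (n : Occ d) : ℝ :=
  ∏ j ∈ Λ, Real.exp (-β * n j) / partFn β

/-- The complex power `ρ_Λ^z`, acting diagonally. -/
def rhoPow (β : ℝ) (Λ : Finset (Site d)) (z : ℂ) : Op d :=
  Finsupp.linearCombination ℂ (fun n : Occ d => ((gibbsWeight β Λ n : ℂ) ^ z) • basisVec n)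

/-- The labels of the occupation number basis of `H_Λ`. -/
abbrev LocalOcc (Λ : Finset (Site d)) : Type := {n : Occ d // n.support ⊆ Λ}

/-- `Tr_Λ (ρ_Λ f)`. -/
def localExp (β : ℝ) (Λ : Finset (Site d)) (f : Op d) : ℂ :=
  ∑' n : LocalOcc Λ, matElem (rhoPow β Λ 1 * f) n n

/-- `Tr_Λ |ρ_Λ^{1/4} f ρ_Λ^{1/4}|²`, as a sum of squares of matrix elements. -/
def localNormSq (β : ℝ) (Λ : Finset (Site d)) (f : Op d) : ℝ≥0∞ :=
  ∑' (m : LocalOcc Λ) (n : LocalOcc Λ),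
    ENNReal.ofReal (‖matElem (rhoPow β Λ (1 / 4) * f * rhoPow β Λ (1 / 4)) m n‖ ^ 2)

/-- The product state `ω₀(f) = lim_Λ Tr_Λ (ρ_Λ f)`, along finite `Λ` increasing to `ℤ^d`. -/
def omega0 (β : ℝ) (f : Op d) : ℂ := limUnder atTop (fun Λ => localExp β Λ f)

/-- `‖f‖²_{2,ω₀} = lim_Λ Tr_Λ |ρ_Λ^{1/4} f ρ_Λ^{1/4}|²`. -/
def normSq (β : ℝ) (f : Op d) : ℝ≥0∞ := limUnder atTop (fun Λ => localNormSq β Λ f)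

/-- The modular dynamics `α_{t,Λ}(B) = ρ_Λ^{it} B ρ_Λ^{-it}`, for real or complex `t`. -/
def modular (β : ℝ) (Λ : Finset (Site d)) (t : ℂ) (B : Op d) : Op d :=
  rhoPow β Λ (Complex.I * t) * B * rhoPow β Λ (-(Complex.I * t))

/-- The form `ℰ_{I,J}(f) = ∑_k ‖δ_{A(I+k,J+k)} f‖²_{2,ω₀}`. -/
def dirichletForm (β : ℝ) (I J : Finset (Site d)) (f : Op d) : ℝ≥0∞ :=
  ∑' k : Site d, normSq β (innerDer (opA (shift I k) (shift J k)) f)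

/-- The Poincaré inequality `m ‖f - ω₀(f)‖²_{2,ω₀} ≤ ℰ(f)` on `𝒟`, with some `m > 0`. -/
def PoincareInequality (β : ℝ) (E : Op d → ℝ≥0∞) : Prop :=
  ∃ m : ℝ, 0 < m ∧ ∀ f ∈ polyAlg d,
    ENNReal.ofReal m * normSq β (f - algebraMap ℂ (Op d) (omega0 β f)) ≤ E f

end LatticeBosons

end

/-!
Every operator in `𝒟` lies in `localAlg Λ` for some finite `Λ`: it commutes with everything that acts
outside `Λ`. Its matrix elements are therefore diagonal in, and independent of, the occupation numbers
outside `Λ`, and since a one-site density has trace one, the finite volume traces and norms are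
constant as soon as the volume contains `Λ` (`localExp_union`, `localNormSq_union`). They are finite
because operators in `𝒟` are bounded between exponentially weighted `ℓ¹` spaces with arbitrarily
small loss in the exponent (`isTempered_of_mem_polyAlg`), while the square root of the Gibbs weight
decays exponentially with a fixed rate. Only finitely many translates of `A(I,J)` fail to commute with
a local operator, so the form is finite.

The operator `A(I,J)` maps `e_n` to a multiple of one vector `e_m` with the same number of particles
in any `Λ ⊇ I ∪ J`. The Gibbs weight in `Λ` depends only on that number, which gives the modular
invariance.

The Poincaré inequality fails for the centered particle number `∑_{j ∈ Λ} (N_j - ω₀(N_j))` of a large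
box `Λ`. By independence of the sites its squared norm is `|Λ|` times the one-site variance, since
the operator is diagonal and commutes with the density (`normSq_centeredNumber`). Its commutator with
a translate of `A(I,J)` is that translate times the number of particles it carries into `Λ`
(`innerDer_opA_centeredNumber`). This number vanishes unless the translate straddles the boundary of
`Λ`, and `‖A(I,J)‖²_{2,ω₀}` is bounded by a constant depending only on `|I| = |J|`
(`normSq_opA_le`); so the form is of the order of the boundary of `Λ`
(`dirichletForm_centeredNumber_box_le`), which is negligible compared with its volume.
-/

namespace LatticeBosons

variable {d : ℕ}

/-! ### Operators in the occupation number basis -/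

theorem ann_commute_cre {i j : Site d} (hij : i ≠ j) : Commute (ann i) (cre j) := by
  apply op_ext
  intro n
  have h1 : (n + Finsupp.single j 1 : Occ d) i = n i := by simp [hij.symm]
  have h2 : (n - Finsupp.single i 1 : Occ d) j = n j := by simp [hij]
  have h3 : n + Finsupp.single j 1 - Finsupp.single i 1
      = n - Finsupp.single i 1 + Finsupp.single j 1 := by
    ext l
    by_cases hl : l = i
    · subst hl; simp [hij.symm]
    · simp [Finsupp.single_apply, Ne.symm hl]
  simp only [Module.End.mul_apply, ann_basisVec, cre_basisVec, map_smul, smul_smul, h1, h2, h3]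
  rw [mul_comm]

/-- The number operator `N_j = A_j^* A_j`. -/
noncomputable def number (j : Site d) : Op d := cre j * ann j

theorem number_basisVec (j : Site d) (n : Occ d) :
    number j (basisVec n) = (n j : ℂ) • basisVec n := by
  rcases Nat.eq_zero_or_pos (n j) with h | h
  · simp [number, ann_basisVec, h]
  · have h1 : n - Finsupp.single j 1 + Finsupp.single j 1 = n :=
      tsub_add_cancel_of_le (by simpa using Nat.succ_le_of_lt h)
    have h2 : (((n - Finsupp.single j 1 : Occ d) j : ℕ) : ℝ) + 1 = n j := by
      have := DFunLike.congr_fun h1 j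
      simp only [Finsupp.add_apply, Finsupp.single_eq_same] at this
      exact_mod_cast this
    rw [number, Module.End.mul_apply, ann_basisVec, map_smul, cre_basisVec, h1, h2, smul_smul,
      ← Complex.ofReal_mul, Real.mul_self_sqrt (Nat.cast_nonneg _), Complex.ofReal_natCast]

/-- If `f e_n = c_n e_n` for all `n`, then `f` multiplies coefficients by `c`. -/
theorem apply_of_diagonal {f : Op d} {c : Occ d → ℂ}
    (h : ∀ n, f (basisVec n) = c n • basisVec n) (v : Fock d) (m : Occ d) :
    f v m = c m * v m := by
  induction v using Finsupp.induction_linear with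
  | zero => simp
  | add u v hu hv => simp [hu, hv, mul_add]
  | single n a =>
    have : (Finsupp.single n a : Fock d) = a • basisVec n := by simp [basisVec]
    rw [this, map_smul, h]
    by_cases hmn : n = m
    · subst hmn; simp [basisVec, mul_comm]
    · simp [basisVec, hmn]

theorem number_apply (j : Site d) (v : Fock d) (m : Occ d) : number j v m = m j * v m :=
  apply_of_diagonal (number_basisVec j) v m

theorem rhoPow_basisVec (β : ℝ) (Λ : Finset (Site d)) (z : ℂ) (n : Occ d) :
    rhoPow β Λ z (basisVec n) = ((gibbsWeight β Λ n : ℂ) ^ z) • basisVec n := by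
  simp [rhoPow, basisVec, Finsupp.linearCombination_single]

theorem rhoPow_apply (β : ℝ) (Λ : Finset (Site d)) (z : ℂ) (v : Fock d) (m : Occ d) :
    rhoPow β Λ z v m = (gibbsWeight β Λ m : ℂ) ^ z * v m :=
  apply_of_diagonal (rhoPow_basisVec β Λ z) v m

/-- The isometry `e_n ↦ e_{n + r}`. -/
noncomputable def shiftOp (r : Occ d) : Op d := Finsupp.lmapDomain ℂ ℂ (fun n => n + r)

theorem shiftOp_basisVec (r n : Occ d) : shiftOp r (basisVec n) = basisVec (n + r) := by
  simp [shiftOp, basisVec, Finsupp.mapDomain_single]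

theorem shiftOp_apply_add (r : Occ d) (v : Fock d) (m : Occ d) :
    shiftOp r v (m + r) = v m :=
  Finsupp.mapDomain_apply (add_left_injective r) v m

theorem ann_commute_shiftOp {j : Site d} {r : Occ d} (hr : r j = 0) :
    Commute (ann j) (shiftOp r) := by
  apply op_ext
  intro n
  have h1 : (n + r : Occ d) j = n j := by simp [hr]
  have h2 : n + r - Finsupp.single j 1 = n - Finsupp.single j 1 + r := by
    ext l
    by_cases hl : l = j
    · subst hl; simp [hr]
    · simp [Ne.symm hl]
  simp only [Module.End.mul_apply, ann_basisVec, shiftOp_basisVec, map_smul, h1, h2]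

theorem cre_commute_shiftOp {j : Site d} {r : Occ d} (hr : r j = 0) :
    Commute (cre j) (shiftOp r) := by
  apply op_ext
  intro n
  have h1 : (n + r : Occ d) j = n j := by simp [hr]
  simp only [Module.End.mul_apply, cre_basisVec, shiftOp_basisVec, map_smul, h1,
    add_right_comm n r]

/-! ### Local operators -/

/-- Operators acting only outside `Λ`: the `A_j`, `A_j^*` with `j ∉ Λ`, and the isometries that add
particles outside `Λ`. -/
def outerOps (Λ : Finset (Site d)) : Set (Op d) :=
  ann '' {j | j ∉ Λ} ∪ cre '' {j | j ∉ Λ} ∪ shiftOp '' {r | ∀ j ∈ Λ, r j = 0}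

/-- The operators localized in `Λ`, encoded as the commutant of everything that acts outside `Λ`. -/
noncomputable def localAlg (Λ : Finset (Site d)) : Subalgebra ℂ (Op d) :=
  Subalgebra.centralizer ℂ (outerOps Λ)

theorem localAlg_mono {Λ Λ' : Finset (Site d)} (h : Λ ⊆ Λ') : localAlg Λ ≤ localAlg Λ' := by
  refine Subalgebra.centralizer_le ℂ _ _ ?_
  refine Set.union_subset_union (Set.union_subset_union ?_ ?_) ?_ <;> apply Set.image_mono
  · exact fun j hj hj' => hj (h hj')
  · exact fun j hj hj' => hj (h hj')
  · exact fun r hr j hj => hr j (h hj)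

theorem mem_localAlg_iff {Λ : Finset (Site d)} {f : Op d} :
    f ∈ localAlg Λ ↔ (∀ j ∉ Λ, Commute (ann j) f) ∧ (∀ j ∉ Λ, Commute (cre j) f) ∧
      ∀ r : Occ d, (∀ j ∈ Λ, r j = 0) → Commute (shiftOp r) f := by
  simp only [localAlg, outerOps, Subalgebra.mem_centralizer_iff, Set.mem_union, or_imp,
    forall_and, Set.forall_mem_image, Set.mem_ofPred_eq, and_assoc]
  rfl

theorem ann_mem_localAlg (j : Site d) : ann j ∈ localAlg {j} := by
  refine mem_localAlg_iff.2 ⟨fun i _ => ann_commute i j, fun i hi => ?_, fun r hr => ?_⟩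
  · exact (ann_commute_cre (fun h => hi (by simp [h]))).symm
  · exact (ann_commute_shiftOp (hr j (by simp))).symm

theorem cre_mem_localAlg (j : Site d) : cre j ∈ localAlg {j} := by
  refine mem_localAlg_iff.2 ⟨fun i hi => ?_, fun i _ => cre_commute i j, fun r hr => ?_⟩
  · exact ann_commute_cre (fun h => hi (by simp [h]))
  · exact (cre_commute_shiftOp (hr j (by simp))).symm

theorem exists_mem_localAlg {f : Op d} (hf : f ∈ polyAlg d) :
    ∃ Λ : Finset (Site d), f ∈ localAlg Λ := by
  classical
  induction hf using Algebra.adjoin_induction with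
  | mem x hx =>
    rcases hx with ⟨j, rfl⟩ | ⟨j, rfl⟩
    · exact ⟨{j}, ann_mem_localAlg j⟩
    · exact ⟨{j}, cre_mem_localAlg j⟩
  | algebraMap r => exact ⟨∅, Subalgebra.algebraMap_mem _ r⟩
  | add x y _ _ hx hy =>
    obtain ⟨Λ, hx⟩ := hx
    obtain ⟨Λ', hy⟩ := hy
    exact ⟨Λ ∪ Λ', add_mem (localAlg_mono Finset.subset_union_left hx)
      (localAlg_mono Finset.subset_union_right hy)⟩
  | mul x y _ _ hx hy =>
    obtain ⟨Λ, hx⟩ := hx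
    obtain ⟨Λ', hy⟩ := hy
    exact ⟨Λ ∪ Λ', mul_mem (localAlg_mono Finset.subset_union_left hx)
      (localAlg_mono Finset.subset_union_right hy)⟩

/-- A local operator commutes with `N_j` outside its support, so it preserves `n_j` there. -/
theorem matElem_eq_zero_of_mem_localAlg {Λ : Finset (Site d)} {f : Op d} (hf : f ∈ localAlg Λ)
    {m n : Occ d} {j : Site d} (hj : j ∉ Λ) (hmn : m j ≠ n j) : matElem f m n = 0 := by
  have h := mem_localAlg_iff.1 hf
  have hc : Commute (number j) f := (h.2.1 j hj).mul_left (h.1 j hj)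
  have h1 : number j (f (basisVec n)) m = f (number j (basisVec n)) m :=
    DFunLike.congr_fun (LinearMap.congr_fun hc.eq (basisVec n)) m
  rw [number_apply, number_basisVec, map_smul, Finsupp.smul_apply, smul_eq_mul] at h1
  exact (mul_eq_mul_right_iff.1 h1).resolve_left (by exact_mod_cast hmn)

theorem matElem_add_of_mem_localAlg {Λ : Finset (Site d)} {f : Op d} (hf : f ∈ localAlg Λ)
    {r : Occ d} (hr : ∀ j ∈ Λ, r j = 0) (m n : Occ d) :
    matElem f (m + r) (n + r) = matElem f m n := by
  have h := ((mem_localAlg_iff.1 hf).2.2 r hr).eq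
  rw [matElem, ← shiftOp_basisVec, ← Module.End.mul_apply, ← h, Module.End.mul_apply,
    shiftOp_apply_add, matElem]

/-! ### Exponentially weighted bounds -/

/-- The weighted `ℓ¹` norm `∑_m |v_m| e^{s |m|}`, where `|m|` is the total particle number. -/
noncomputable def expNorm (s : ℝ) (v : Fock d) : ℝ≥0∞ :=
  ∑' m, ‖v m‖ₑ * ENNReal.ofReal (Real.exp (s * m.degree))

/-- `f` is bounded from each exponentially weighted `ℓ¹` norm to every weaker one. -/
def IsTempered (f : Op d) : Prop :=
  ∀ s s' : ℝ, 0 ≤ s → s < s' → ∃ C : ℝ, 0 ≤ C ∧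
    ∀ v, expNorm s (f v) ≤ ENNReal.ofReal C * expNorm s' v

theorem expNorm_add_le (s : ℝ) (u v : Fock d) :
    expNorm s (u + v) ≤ expNorm s u + expNorm s v := by
  rw [expNorm, expNorm, expNorm, ← ENNReal.tsum_add]
  refine ENNReal.tsum_le_tsum fun m => ?_
  rw [← add_mul]
  gcongr
  exact enorm_add_le _ _

theorem expNorm_smul (s : ℝ) (c : ℂ) (v : Fock d) : expNorm s (c • v) = ‖c‖ₑ * expNorm s v := by
  simp only [expNorm, Finsupp.smul_apply, smul_eq_mul, enorm_mul, mul_assoc, ENNReal.tsum_mul_left]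

theorem expNorm_basisVec (s : ℝ) (n : Occ d) :
    expNorm s (basisVec n) = ENNReal.ofReal (Real.exp (s * n.degree)) := by
  rw [expNorm, tsum_eq_single n]
  · simp [basisVec]
  · intro m hm
    simp [basisVec, hm.symm]

theorem expNorm_sum_le (s : ℝ) {ι : Type*} (t : Finset ι) (v : ι → Fock d) :
    expNorm s (∑ i ∈ t, v i) ≤ ∑ i ∈ t, expNorm s (v i) := by
  classical
  induction t using Finset.induction_on with
  | empty => simp [expNorm]
  | insert a t ha ih =>
    rw [Finset.sum_insert ha, Finset.sum_insert ha]
    exact (expNorm_add_le _ _ _).trans (by gcongr)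

theorem expNorm_mono {s s' : ℝ} (h : s ≤ s') (v : Fock d) : expNorm s v ≤ expNorm s' v := by
  unfold expNorm
  gcongr

/-- It is enough to bound the image of basis vectors. -/
theorem isTempered_of_basisVec {f : Op d}
    (h : ∀ s s' : ℝ, 0 ≤ s → s < s' → ∃ C : ℝ, 0 ≤ C ∧ ∀ n : Occ d,
      expNorm s (f (basisVec n)) ≤ ENNReal.ofReal (C * Real.exp (s' * n.degree))) :
    IsTempered f := by
  intro s s' hs hss
  obtain ⟨C, hC, hb⟩ := h s s' hs hss
  refine ⟨C, hC, fun v => ?_⟩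
  have hv : v = ∑ n ∈ v.support, v n • basisVec n := by
    conv_lhs => rw [← Finsupp.sum_single v]
    simp [Finsupp.sum, basisVec]
  have hv' : expNorm s' v
      = ∑ n ∈ v.support, ‖v n‖ₑ * ENNReal.ofReal (Real.exp (s' * n.degree)) := by
    refine tsum_eq_sum fun n hn => ?_
    simp [Finsupp.notMem_support_iff.1 hn]
  calc expNorm s (f v) = expNorm s (∑ n ∈ v.support, v n • f (basisVec n)) := by
        conv_lhs => rw [hv]
        simp only [map_sum, map_smul]
    _ ≤ ∑ n ∈ v.support, ‖v n‖ₑ * expNorm s (f (basisVec n)) :=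
        (expNorm_sum_le _ _ _).trans_eq (by simp only [expNorm_smul])
    _ ≤ ∑ n ∈ v.support,
          ‖v n‖ₑ * (ENNReal.ofReal C * ENNReal.ofReal (Real.exp (s' * n.degree))) := by
        gcongr with n hn
        exact (hb n).trans_eq (ENNReal.ofReal_mul hC)
    _ = ENNReal.ofReal C * expNorm s' v := by
        rw [hv', Finset.mul_sum]
        exact Finset.sum_congr rfl fun n _ => by ring

/-- The factor `√(x + 1)` of a creation operator is absorbed by `e^{(s' - s) x}`. -/
theorem sqrt_mul_exp_le {s s' : ℝ} (h : s < s') {x y : ℝ} (hy : 0 ≤ y) (hyx : y ≤ x) :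
    √(y + 1) * Real.exp (s * (x + 1)) ≤ ((s' - s)⁻¹ + 1) * Real.exp s * Real.exp (s' * x) := by
  have hε : 0 < s' - s := sub_pos.2 h
  have hx : 0 ≤ x := hy.trans hyx
  have h1 : √(y + 1) ≤ x + 1 := by
    rw [Real.sqrt_le_left (by linarith)]
    nlinarith
  have h2 : (s' - s) * x + 1 ≤ Real.exp ((s' - s) * x) := Real.add_one_le_exp _
  have h3 : x + 1 ≤ ((s' - s)⁻¹ + 1) * Real.exp ((s' - s) * x) := by
    have h4 : 1 ≤ Real.exp ((s' - s) * x) := Real.one_le_exp (by positivity)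
    have h5 : x ≤ (s' - s)⁻¹ * Real.exp ((s' - s) * x) := by
      rw [le_inv_mul_iff₀ hε]
      linarith
    linarith
  calc √(y + 1) * Real.exp (s * (x + 1))
      ≤ ((s' - s)⁻¹ + 1) * Real.exp ((s' - s) * x) * Real.exp (s * (x + 1)) := by
        gcongr
        exact h1.trans h3
    _ = ((s' - s)⁻¹ + 1) * Real.exp s * Real.exp (s' * x) := by
        rw [mul_assoc, mul_assoc, ← Real.exp_add, ← Real.exp_add]
        ring_nf

theorem isTempered_cre (j : Site d) : IsTempered (cre j) := by
  refine isTempered_of_basisVec fun s s' hs h => ⟨((s' - s)⁻¹ + 1) * Real.exp s, ?_, fun n => ?_⟩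
  · have : 0 < s' - s := sub_pos.2 h
    positivity
  · rw [cre_basisVec, expNorm_smul, expNorm_basisVec, ← ofReal_norm, Complex.norm_real,
      ← ENNReal.ofReal_mul (norm_nonneg _), Real.norm_of_nonneg (Real.sqrt_nonneg _)]
    refine ENNReal.ofReal_le_ofReal ?_
    have := sqrt_mul_exp_le h (Nat.cast_nonneg (n j)) (Nat.cast_le.2 (Finsupp.le_degree j n))
    simpa using this

theorem isTempered_ann (j : Site d) : IsTempered (ann j) := by
  refine isTempered_of_basisVec fun s s' hs h => ⟨((s' - s)⁻¹ + 1) * Real.exp s, ?_, fun n => ?_⟩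
  · have : 0 < s' - s := sub_pos.2 h
    positivity
  · rw [ann_basisVec, expNorm_smul, expNorm_basisVec, ← ofReal_norm, Complex.norm_real,
      ← ENNReal.ofReal_mul (norm_nonneg _), Real.norm_of_nonneg (Real.sqrt_nonneg _)]
    refine ENNReal.ofReal_le_ofReal (le_trans ?_
      (sqrt_mul_exp_le h (Nat.cast_nonneg (n j)) (Nat.cast_le.2 (Finsupp.le_degree j n))))
    have hdeg : ((n - Finsupp.single j 1 : Occ d).degree : ℝ) ≤ n.degree + 1 := by
      have : (n - Finsupp.single j 1 : Occ d).degree ≤ n.degree :=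
        Finsupp.degree_mono tsub_le_self
      have := (Nat.cast_le (α := ℝ)).2 this
      linarith
    gcongr
    linarith

theorem isTempered_of_mem_polyAlg {f : Op d} (hf : f ∈ polyAlg d) : IsTempered f := by
  induction hf using Algebra.adjoin_induction with
  | mem x hx =>
    rcases hx with ⟨j, rfl⟩ | ⟨j, rfl⟩
    · exact isTempered_ann j
    · exact isTempered_cre j
  | algebraMap r =>
    intro s s' _ h
    refine ⟨‖r‖, norm_nonneg _, fun v => ?_⟩
    rw [Module.algebraMap_end_apply, expNorm_smul, ofReal_norm]
    gcongr
    exact expNorm_mono h.le v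
  | add x y _ _ hx hy =>
    intro s s' hs h
    obtain ⟨C, hC, hx⟩ := hx s s' hs h
    obtain ⟨D, hD, hy⟩ := hy s s' hs h
    refine ⟨C + D, add_nonneg hC hD, fun v => ?_⟩
    rw [ENNReal.ofReal_add hC hD, add_mul]
    exact (expNorm_add_le _ _ _).trans (add_le_add (hx v) (hy v))
  | mul x y _ _ hx hy =>
    intro s s' hs h
    obtain ⟨t, hst, hts⟩ := exists_between h
    obtain ⟨C, hC, hx⟩ := hx s t hs hst
    obtain ⟨D, hD, hy⟩ := hy t s' (hs.trans hst.le) hts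
    refine ⟨C * D, mul_nonneg hC hD, fun v => ?_⟩
    rw [ENNReal.ofReal_mul hC, mul_assoc, Module.End.mul_apply]
    refine (hx _).trans ?_
    gcongr
    exact hy v

variable {β : ℝ}

/-! ### Sums over local occupation numbers -/

theorem LocalOcc.apply_eq_zero {Λ : Finset (Site d)} (n : LocalOcc Λ) {j : Site d} (hj : j ∉ Λ) :
    n.1 j = 0 :=
  Finsupp.notMem_support_iff.1 fun h => hj (n.2 h)

/-- Occupation numbers in a disjoint union are pairs of occupation numbers. -/
noncomputable def localOccUnion {Λ Λ' : Finset (Site d)} (h : Disjoint Λ Λ') :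
    LocalOcc Λ × LocalOcc Λ' ≃ LocalOcc (Λ ∪ Λ') where
  toFun p := ⟨p.1.1 + p.2.1,
    Finsupp.support_add.trans (Finset.union_subset_union p.1.2 p.2.2)⟩
  invFun n := (⟨n.1.filter (· ∈ Λ), fun j hj => by
      rw [Finsupp.support_filter, Finset.mem_filter] at hj; exact hj.2⟩,
    ⟨n.1.filter (· ∈ Λ'), fun j hj => by
      rw [Finsupp.support_filter, Finset.mem_filter] at hj; exact hj.2⟩)
  left_inv p := by
    refine Prod.ext (Subtype.ext (Finsupp.ext fun j => ?_)) (Subtype.ext (Finsupp.ext fun j => ?_))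
    · by_cases hj : j ∈ Λ
      · simp [hj, p.2.apply_eq_zero (Finset.disjoint_left.1 h hj)]
      · simp [hj, p.1.apply_eq_zero hj]
    · by_cases hj : j ∈ Λ'
      · simp [hj, p.1.apply_eq_zero (Finset.disjoint_right.1 h hj)]
      · simp [hj, p.2.apply_eq_zero hj]
  right_inv n := by
    refine Subtype.ext (Finsupp.ext fun j => ?_)
    by_cases hj : j ∈ Λ
    · simp [hj, Finset.disjoint_left.1 h hj]
    · by_cases hj' : j ∈ Λ'
      · simp [hj, hj']
      · simp [hj, hj', n.apply_eq_zero (j := j) (by simp [hj, hj'])]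

/-- Occupation numbers of a single site. -/
noncomputable def localOccSingleton (a : Site d) : ℕ ≃ LocalOcc ({a} : Finset (Site d)) where
  toFun k := ⟨Finsupp.single a k, Finsupp.support_single_subset⟩
  invFun n := n.1 a
  left_inv k := by simp
  right_inv n := by
    refine Subtype.ext (Finsupp.ext fun j => ?_)
    by_cases hj : j = a
    · subst hj; simp
    · simp [Ne.symm hj, n.apply_eq_zero (j := j) (by simp [hj])]

/-- Independence of distinct sites: a sum of products over sites is the product of the sums. -/
theorem hasSum_localOcc_prod (Λ : Finset (Site d)) (g : Site d → ℕ → ℝ)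
    (hg : ∀ j ∈ Λ, Summable (g j)) :
    HasSum (fun n : LocalOcc Λ => ∏ j ∈ Λ, g j (n.1 j)) (∏ j ∈ Λ, ∑' k, g j k) := by
  induction Λ using Finset.induction_on with
  | empty =>
    have : Unique (LocalOcc (∅ : Finset (Site d))) :=
      { default := ⟨0, by simp⟩
        uniq := fun n => Subtype.ext (Finsupp.ext fun j => n.apply_eq_zero (by simp)) }
    simp
  | insert a Λ ha ih =>
    have hd : Disjoint {a} Λ := Finset.disjoint_singleton_left.2 ha
    have ih := ih fun j hj => hg j (Finset.mem_insert_of_mem hj)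
    have h1 : HasSum (g a) (∑' k, g a k) := (hg a (Finset.mem_insert_self a Λ)).hasSum
    have h2 := HasSum.mul (f := g a) (g := fun n : LocalOcc Λ => ∏ j ∈ Λ, g j (n.1 j)) h1 ih
      (summable_mul_of_summable_norm (f := g a) (g := fun n : LocalOcc Λ => ∏ j ∈ Λ, g j (n.1 j))
        h1.summable.norm ih.summable.norm)
    rw [Finset.prod_insert ha]
    simp only [Finset.insert_eq]
    rw [← (((localOccSingleton a).prodCongr (Equiv.refl (LocalOcc Λ))).trans
      (localOccUnion hd)).hasSum_iff]
    refine (congrArg (fun F => HasSum F _) (funext fun p => ?_)).mpr h2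
    have hval : (((localOccSingleton a).prodCongr (Equiv.refl (LocalOcc Λ))).trans
        (localOccUnion hd) p).1 = Finsupp.single a p.1 + p.2.1 := rfl
    rw [Function.comp_apply, Finset.prod_union hd, Finset.prod_singleton, hval]
    congr 1
    · simp [p.2.apply_eq_zero ha]
    · refine Finset.prod_congr rfl fun j hj => ?_
      have hja : j ≠ a := fun h => ha (h ▸ hj)
      simp [hja.symm]

/-- The one-site Gibbs weight `Z⁻¹ e^{-β k}`. -/
noncomputable def siteWeight (β : ℝ) (k : ℕ) : ℝ := Real.exp (-β * k) / partFn β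

theorem summable_exp_neg {b : ℝ} (hb : 0 < b) : Summable fun k : ℕ => Real.exp (-b * k) := by
  simpa using Real.summable_pow_mul_exp_neg_nat_mul 0 hb

theorem partFn_pos (hβ : 0 < β) : 0 < partFn β :=
  (summable_exp_neg hβ).tsum_pos (fun _ => (Real.exp_pos _).le) 0 (Real.exp_pos _)

theorem siteWeight_pos (hβ : 0 < β) (k : ℕ) : 0 < siteWeight β k :=
  div_pos (Real.exp_pos _) (partFn_pos hβ)

theorem hasSum_siteWeight (hβ : 0 < β) : HasSum (siteWeight β) 1 := by
  have h : HasSum (fun k : ℕ => Real.exp (-β * k)) (partFn β) := (summable_exp_neg hβ).hasSum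
  have := h.div_const (partFn β)
  rwa [div_self (partFn_pos hβ).ne'] at this

theorem siteWeight_le_one (hβ : 0 < β) (k : ℕ) : siteWeight β k ≤ 1 :=
  le_hasSum (hasSum_siteWeight hβ) k fun _ _ => (siteWeight_pos hβ _).le

theorem summable_pow_mul_siteWeight (hβ : 0 < β) (p : ℕ) :
    Summable fun k : ℕ => (k : ℝ) ^ p * siteWeight β k := by
  simpa only [siteWeight, mul_div_assoc] using
    (Real.summable_pow_mul_exp_neg_nat_mul p hβ).div_const (partFn β)

theorem gibbsWeight_eq (Λ : Finset (Site d)) (n : Occ d) :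
    gibbsWeight β Λ n = ∏ j ∈ Λ, siteWeight β (n j) := rfl

theorem gibbsWeight_pos (hβ : 0 < β) (Λ : Finset (Site d)) (n : Occ d) : 0 < gibbsWeight β Λ n :=
  Finset.prod_pos fun _ _ => siteWeight_pos hβ _

theorem gibbsWeight_le_one (hβ : 0 < β) (Λ : Finset (Site d)) (n : Occ d) :
    gibbsWeight β Λ n ≤ 1 :=
  Finset.prod_le_one (fun _ _ => (siteWeight_pos hβ _).le) fun _ _ => siteWeight_le_one hβ _

theorem hasSum_gibbsWeight (hβ : 0 < β) (Λ : Finset (Site d)) :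
    HasSum (fun n : LocalOcc Λ => gibbsWeight β Λ n.1) 1 := by
  have := hasSum_localOcc_prod Λ (fun _ => siteWeight β) fun _ _ => (hasSum_siteWeight hβ).summable
  rwa [(hasSum_siteWeight hβ).tsum_eq, Finset.prod_const_one] at this

theorem gibbsWeight_union {Λ Λ' : Finset (Site d)} (h : Disjoint Λ Λ')
    (n : LocalOcc Λ) (r : LocalOcc Λ') :
    gibbsWeight β (Λ ∪ Λ') (n.1 + r.1) = gibbsWeight β Λ n.1 * gibbsWeight β Λ' r.1 := by
  rw [gibbsWeight_eq, gibbsWeight_eq, gibbsWeight_eq, Finset.prod_union h]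
  congr 1 <;> refine Finset.prod_congr rfl fun j hj => ?_
  · simp [r.apply_eq_zero (Finset.disjoint_left.1 h hj)]
  · simp [n.apply_eq_zero (Finset.disjoint_right.1 h hj)]

/-- The square root of the Gibbs weight still beats the exponential weight `e^{β |n| / 4}`. -/
theorem summable_sqrt_gibbsWeight_mul_exp (hβ : 0 < β) (Λ : Finset (Site d)) :
    Summable fun n : LocalOcc Λ => √(gibbsWeight β Λ n.1) * Real.exp (β / 4 * n.1.degree) := by
  have hs : Summable fun k : ℕ => √(siteWeight β k) * Real.exp (β / 4 * k) := by
    refine ((summable_exp_neg (b := β / 4) (by positivity)).div_const √(partFn β)).congr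
      fun k => ?_
    rw [siteWeight, Real.sqrt_div (Real.exp_pos _).le, ← Real.exp_half, div_mul_eq_mul_div,
      ← Real.exp_add]
    ring_nf
  refine (hasSum_localOcc_prod Λ (fun _ k => √(siteWeight β k) * Real.exp (β / 4 * k))
    fun _ _ => hs).summable.congr fun n => ?_
  have hdeg : n.1.degree = ∑ j ∈ Λ, n.1 j :=
    Finset.sum_subset n.2 fun j _ hj => Finsupp.notMem_support_iff.1 hj
  rw [Finset.prod_mul_distrib, gibbsWeight_eq, Real.sqrt_prod _ fun _ _ => (siteWeight_pos hβ _).le,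
    ← Real.exp_sum, ← Finset.mul_sum, hdeg, Nat.cast_sum]

/-! ### Traces, norms and their infinite volume limits -/

theorem matElem_rhoPow_mul (Λ : Finset (Site d)) (f : Op d) (m n : Occ d) :
    matElem (rhoPow β Λ 1 * f) m n = gibbsWeight β Λ m * matElem f m n := by
  rw [matElem, Module.End.mul_apply, rhoPow_apply, Complex.cpow_one, matElem]

theorem norm_sq_matElem_rhoPow (hβ : 0 < β) (Λ : Finset (Site d)) (f : Op d) (m n : Occ d) :
    ‖matElem (rhoPow β Λ (1 / 4) * f * rhoPow β Λ (1 / 4)) m n‖ ^ 2 =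
      √(gibbsWeight β Λ m) * √(gibbsWeight β Λ n) * ‖matElem f m n‖ ^ 2 := by
  have h : ∀ l : Occ d, ‖(gibbsWeight β Λ l : ℂ) ^ (1 / 4 : ℂ)‖ ^ 2 = √(gibbsWeight β Λ l) := by
    intro l
    have h4 : (1 / 4 : ℂ).re = 1 / 4 := by norm_num
    rw [Complex.norm_cpow_eq_rpow_re_of_pos (gibbsWeight_pos hβ Λ l), ← Real.rpow_natCast,
      ← Real.rpow_mul (gibbsWeight_pos hβ Λ l).le, Real.sqrt_eq_rpow, h4]
    norm_num
  rw [matElem, Module.End.mul_apply, Module.End.mul_apply, rhoPow_basisVec, map_smul, rhoPow_apply,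
    Finsupp.smul_apply, smul_eq_mul, norm_mul, norm_mul, mul_pow, mul_pow, h, h, matElem]
  ring

theorem localNormSq_eq (hβ : 0 < β) (Λ : Finset (Site d)) (f : Op d) :
    localNormSq β Λ f = ∑' (m : LocalOcc Λ) (n : LocalOcc Λ), ENNReal.ofReal
      (√(gibbsWeight β Λ m.1) * √(gibbsWeight β Λ n.1) * ‖matElem f m.1 n.1‖ ^ 2) := by
  simp only [localNormSq, norm_sq_matElem_rhoPow hβ]

theorem exists_tsum_enorm_matElem_le (hβ : 0 < β) {f : Op d} (hf : f ∈ polyAlg d) :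
    ∃ C : ℝ, 0 ≤ C ∧ ∀ n : Occ d,
      ∑' m, ‖matElem f m n‖ₑ ≤ ENNReal.ofReal (C * Real.exp (β / 8 * n.degree)) := by
  obtain ⟨C, hC, h⟩ := isTempered_of_mem_polyAlg hf 0 (β / 8) le_rfl (by positivity)
  refine ⟨C, hC, fun n => ?_⟩
  have := h (basisVec n)
  rw [expNorm_basisVec, ← ENNReal.ofReal_mul hC] at this
  simpa [expNorm, matElem] using this

theorem summable_trace (hβ : 0 < β) (Λ : Finset (Site d)) {f : Op d} (hf : f ∈ polyAlg d) :
    Summable fun n : LocalOcc Λ => matElem (rhoPow β Λ 1 * f) n.1 n.1 := by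
  obtain ⟨C, hC, h⟩ := exists_tsum_enorm_matElem_le hβ hf
  refine Summable.of_norm_bounded ((summable_sqrt_gibbsWeight_mul_exp hβ Λ).mul_left C) fun n => ?_
  have hw := gibbsWeight_pos hβ Λ n.1
  have h1 : ‖matElem f n.1 n.1‖ ≤ C * Real.exp (β / 8 * n.1.degree) := by
    have := (ENNReal.le_tsum n.1).trans (h n.1)
    rwa [← ofReal_norm, ENNReal.ofReal_le_ofReal_iff (by positivity)] at this
  have h2 : gibbsWeight β Λ n.1 ≤ √(gibbsWeight β Λ n.1) :=
    Real.le_sqrt_of_sq_le (by nlinarith [gibbsWeight_le_one hβ Λ n.1])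
  rw [matElem_rhoPow_mul, norm_mul, Complex.norm_real, Real.norm_of_nonneg hw.le]
  calc gibbsWeight β Λ n.1 * ‖matElem f n.1 n.1‖
      ≤ √(gibbsWeight β Λ n.1) * (C * Real.exp (β / 4 * n.1.degree)) := by
        gcongr
        refine h1.trans ?_
        gcongr
        norm_num
    _ = C * (√(gibbsWeight β Λ n.1) * Real.exp (β / 4 * n.1.degree)) := by ring

theorem tsum_sq_le_sq_tsum {ι : Type*} (x : ι → ℝ≥0∞) : ∑' i, x i ^ 2 ≤ (∑' i, x i) ^ 2 := by
  calc ∑' i, x i ^ 2 ≤ ∑' i, x i * ∑' k, x k := by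
        refine ENNReal.tsum_le_tsum fun i => ?_
        rw [sq]
        gcongr
        exact ENNReal.le_tsum i
    _ = (∑' i, x i) ^ 2 := by rw [ENNReal.tsum_mul_right, sq]

theorem localNormSq_lt_top (hβ : 0 < β) (Λ : Finset (Site d)) {f : Op d} (hf : f ∈ polyAlg d) :
    localNormSq β Λ f < ⊤ := by
  obtain ⟨C, hC, h⟩ := exists_tsum_enorm_matElem_le hβ hf
  rw [localNormSq_eq hβ, ENNReal.tsum_comm]
  have hb : ∀ n : LocalOcc Λ, ∑' m : LocalOcc Λ, ENNReal.ofReal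
      (√(gibbsWeight β Λ m.1) * √(gibbsWeight β Λ n.1) * ‖matElem f m.1 n.1‖ ^ 2) ≤
      ENNReal.ofReal (C ^ 2 * (√(gibbsWeight β Λ n.1) * Real.exp (β / 4 * n.1.degree))) := by
    intro n
    have h1 : ∀ m : LocalOcc Λ, ENNReal.ofReal
        (√(gibbsWeight β Λ m.1) * √(gibbsWeight β Λ n.1) * ‖matElem f m.1 n.1‖ ^ 2) ≤
        ENNReal.ofReal √(gibbsWeight β Λ n.1) * ‖matElem f m.1 n.1‖ₑ ^ 2 := by
      intro m
      rw [← ofReal_norm, ← ENNReal.ofReal_pow (norm_nonneg _),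
        ← ENNReal.ofReal_mul (Real.sqrt_nonneg _)]
      refine ENNReal.ofReal_le_ofReal ?_
      gcongr
      exact mul_le_of_le_one_left (Real.sqrt_nonneg _)
        (Real.sqrt_le_one.2 (gibbsWeight_le_one hβ Λ m.1))
    calc _ ≤ ∑' m : LocalOcc Λ,
          ENNReal.ofReal √(gibbsWeight β Λ n.1) * ‖matElem f m.1 n.1‖ₑ ^ 2 :=
          ENNReal.tsum_le_tsum h1
      _ ≤ ENNReal.ofReal √(gibbsWeight β Λ n.1) * (∑' m, ‖matElem f m n.1‖ₑ) ^ 2 := by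
          rw [ENNReal.tsum_mul_left]
          gcongr
          refine (tsum_sq_le_sq_tsum _).trans ?_
          gcongr
          exact ENNReal.tsum_comp_le_tsum_of_injective Subtype.val_injective
            fun m => ‖matElem f m n.1‖ₑ
      _ ≤ ENNReal.ofReal √(gibbsWeight β Λ n.1) *
          ENNReal.ofReal (C * Real.exp (β / 8 * n.1.degree)) ^ 2 := by
          gcongr
          exact h n.1
      _ = _ := by
          rw [← ENNReal.ofReal_pow (by positivity), ← ENNReal.ofReal_mul (Real.sqrt_nonneg _),
            mul_pow, ← Real.exp_nat_mul]
          congr 1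
          push_cast
          ring_nf
  refine (ENNReal.tsum_le_tsum hb).trans_lt ?_
  rw [lt_top_iff_ne_top]
  exact ((summable_sqrt_gibbsWeight_mul_exp hβ Λ).mul_left _).tsum_ofReal_ne_top

/-- For a local operator the sites outside its support contribute only the factor `Tr ρ = 1`. -/
theorem localExp_union (hβ : 0 < β) {Λ Λ' : Finset (Site d)} (h : Disjoint Λ Λ') {f : Op d}
    (hf : f ∈ polyAlg d) (hl : f ∈ localAlg Λ) : localExp β (Λ ∪ Λ') f = localExp β Λ f := by
  have h1 : Summable fun r : LocalOcc Λ' => ‖(gibbsWeight β Λ' r.1 : ℂ)‖ := by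
    refine (hasSum_gibbsWeight hβ Λ').summable.congr fun r => ?_
    rw [Complex.norm_real, Real.norm_of_nonneg (gibbsWeight_pos hβ Λ' _).le]
  have h2 : ∑' r : LocalOcc Λ', (gibbsWeight β Λ' r.1 : ℂ) = 1 := by
    rw [← Complex.ofReal_tsum, (hasSum_gibbsWeight hβ Λ').tsum_eq, Complex.ofReal_one]
  have h3 := tsum_mul_tsum_of_summable_norm
    (f := fun n : LocalOcc Λ => matElem (rhoPow β Λ 1 * f) n.1 n.1)
    (g := fun r : LocalOcc Λ' => (gibbsWeight β Λ' r.1 : ℂ)) (summable_trace hβ Λ hf).norm h1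
  rw [h2, mul_one] at h3
  rw [localExp, localExp, h3, ← (localOccUnion h).tsum_eq]
  refine tsum_congr fun p => ?_
  have h4 : ((localOccUnion h) p).1 = p.1.1 + p.2.1 := rfl
  rw [h4, matElem_rhoPow_mul, matElem_rhoPow_mul, gibbsWeight_union h,
    matElem_add_of_mem_localAlg hl fun j hj => p.2.apply_eq_zero (Finset.disjoint_left.1 h hj)]
  push_cast
  ring

/-- The analogue of `localExp_union` for the norm: outside the support both matrix indices agree, so
that the two square roots of the weight combine to `Tr ρ = 1`. -/
theorem localNormSq_union (hβ : 0 < β) {Λ Λ' : Finset (Site d)} (h : Disjoint Λ Λ') {f : Op d}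
    (hl : f ∈ localAlg Λ) : localNormSq β (Λ ∪ Λ') f = localNormSq β Λ f := by
  have h1 : ∑' s : LocalOcc Λ', ENNReal.ofReal (gibbsWeight β Λ' s.1) = 1 := by
    rw [← ENNReal.ofReal_tsum_of_nonneg (f := fun s : LocalOcc Λ' => gibbsWeight β Λ' s.1)
      (fun s => (gibbsWeight_pos hβ Λ' s.1).le)
      (hasSum_gibbsWeight hβ Λ').summable, (hasSum_gibbsWeight hβ Λ').tsum_eq, ENNReal.ofReal_one]
  rw [localNormSq_eq hβ, localNormSq_eq hβ, ← (localOccUnion h).tsum_eq, ENNReal.tsum_prod']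
  refine tsum_congr fun m => ?_
  have h2 : ∀ s : LocalOcc Λ', ∑' n : LocalOcc (Λ ∪ Λ'), ENNReal.ofReal
      (√(gibbsWeight β (Λ ∪ Λ') (localOccUnion h (m, s)).1) * √(gibbsWeight β (Λ ∪ Λ') n.1) *
        ‖matElem f (localOccUnion h (m, s)).1 n.1‖ ^ 2) =
      ENNReal.ofReal (gibbsWeight β Λ' s.1) * ∑' n : LocalOcc Λ, ENNReal.ofReal
        (√(gibbsWeight β Λ m.1) * √(gibbsWeight β Λ n.1) * ‖matElem f m.1 n.1‖ ^ 2) := by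
    intro s
    rw [← (localOccUnion h).tsum_eq, ENNReal.tsum_prod', ← ENNReal.tsum_mul_left]
    refine tsum_congr fun n => ?_
    have hval : ∀ p : LocalOcc Λ × LocalOcc Λ', (localOccUnion h p).1 = p.1.1 + p.2.1 :=
      fun _ => rfl
    have hs := gibbsWeight_pos hβ Λ' s.1
    -- A local operator does not change the occupation numbers outside its support.
    rw [tsum_eq_single s]
    · rw [hval, hval, gibbsWeight_union h, gibbsWeight_union h, matElem_add_of_mem_localAlg hl
        fun j hj => s.apply_eq_zero (Finset.disjoint_left.1 h hj), ← ENNReal.ofReal_mul hs.le,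
        Real.sqrt_mul (gibbsWeight_pos hβ Λ _).le, Real.sqrt_mul (gibbsWeight_pos hβ Λ _).le]
      congr 1
      nth_rewrite 3 [← Real.mul_self_sqrt hs.le]
      ring
    · intro r hrs
      obtain ⟨j, hj⟩ := Finsupp.ne_iff.1 fun he => hrs (Subtype.ext he)
      have hjΛ' : j ∈ Λ' := by
        by_contra hc
        exact hj (by rw [r.apply_eq_zero hc, s.apply_eq_zero hc])
      have hjΛ := Finset.disjoint_right.1 h hjΛ'
      rw [hval, hval, matElem_eq_zero_of_mem_localAlg hl hjΛ]
      · simp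
      · simpa [m.apply_eq_zero hjΛ, n.apply_eq_zero hjΛ] using Ne.symm hj
  simp only [h2, ENNReal.tsum_mul_right, h1, one_mul]

theorem eventually_localExp_eq (hβ : 0 < β) {Λ : Finset (Site d)} {f : Op d}
    (hf : f ∈ polyAlg d) (hl : f ∈ localAlg Λ) :
    ∀ᶠ Λ' in atTop, localExp β Λ' f = localExp β Λ f := by
  filter_upwards [eventually_ge_atTop Λ] with Λ' h
  rw [← localExp_union hβ (Finset.disjoint_sdiff (s := Λ) (t := Λ')) hf hl,
    Finset.union_sdiff_of_subset h]

theorem eventually_localNormSq_eq (hβ : 0 < β) {Λ : Finset (Site d)} {f : Op d}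
    (hl : f ∈ localAlg Λ) : ∀ᶠ Λ' in atTop, localNormSq β Λ' f = localNormSq β Λ f := by
  filter_upwards [eventually_ge_atTop Λ] with Λ' h
  rw [← localNormSq_union hβ (Finset.disjoint_sdiff (s := Λ) (t := Λ')) hl,
    Finset.union_sdiff_of_subset h]

theorem omega0_eq_localExp (hβ : 0 < β) {Λ : Finset (Site d)} {f : Op d}
    (hf : f ∈ polyAlg d) (hl : f ∈ localAlg Λ) : omega0 β f = localExp β Λ f :=
  (tendsto_nhds_of_eventually_eq (eventually_localExp_eq hβ hf hl)).limUnder_eq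

theorem normSq_eq_localNormSq (hβ : 0 < β) {Λ : Finset (Site d)} {f : Op d}
    (hl : f ∈ localAlg Λ) : normSq β f = localNormSq β Λ f :=
  (tendsto_nhds_of_eventually_eq (eventually_localNormSq_eq hβ hl)).limUnder_eq

theorem tendsto_localExp (hβ : 0 < β) {f : Op d} (hf : f ∈ polyAlg d) :
    Tendsto (fun Λ => localExp β Λ f) atTop (𝓝 (omega0 β f)) := by
  obtain ⟨Λ, hl⟩ := exists_mem_localAlg hf
  rw [omega0_eq_localExp hβ hf hl]
  exact tendsto_nhds_of_eventually_eq (eventually_localExp_eq hβ hf hl)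

theorem tendsto_localNormSq (hβ : 0 < β) {f : Op d} (hf : f ∈ polyAlg d) :
    Tendsto (fun Λ => localNormSq β Λ f) atTop (𝓝 (normSq β f)) := by
  obtain ⟨Λ, hl⟩ := exists_mem_localAlg hf
  rw [normSq_eq_localNormSq hβ hl]
  exact tendsto_nhds_of_eventually_eq (eventually_localNormSq_eq hβ hl)

theorem normSq_lt_top (hβ : 0 < β) {f : Op d} (hf : f ∈ polyAlg d) : normSq β f < ⊤ := by
  obtain ⟨Λ, hl⟩ := exists_mem_localAlg hf
  rw [normSq_eq_localNormSq hβ hl]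
  exact localNormSq_lt_top hβ Λ hf

/-! ### The hopping operators `A(I,J)` -/

/-- One particle at each site of `I`. -/
noncomputable def indOcc (I : Finset (Site d)) : Occ d := ∑ i ∈ I, Finsupp.single i 1

theorem indOcc_apply (I : Finset (Site d)) (j : Site d) :
    indOcc I j = if j ∈ I then 1 else 0 := by
  simp [indOcc, Finsupp.finsetSum_apply, Finsupp.single_apply]

theorem noncommProd_ann_basisVec (I : Finset (Site d))
    (hc : (I : Set (Site d)).Pairwise (Function.onFun Commute ann)) (n : Occ d) :
    I.noncommProd ann hc (basisVec n) =
      (∏ i ∈ I, (√(n i) : ℂ)) • basisVec (n - indOcc I) := by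
  induction I using Finset.induction_on with
  | empty => simp [Finset.noncommProd_empty, indOcc]
  | insert a I ha ih =>
    have h1 : (n - indOcc I) a = n a := by simp [indOcc_apply, ha]
    have h2 : n - indOcc I - Finsupp.single a 1 = n - indOcc (insert a I) := by
      rw [tsub_tsub, indOcc, indOcc, Finset.sum_insert ha, add_comm]
    rw [Finset.noncommProd_insert_of_notMem _ _ _ _ ha, Module.End.mul_apply, ih _, map_smul,
      ann_basisVec, h1, h2, smul_smul, Finset.prod_insert ha, mul_comm]

theorem noncommProd_cre_basisVec (J : Finset (Site d))
    (hc : (J : Set (Site d)).Pairwise (Function.onFun Commute cre)) (n : Occ d) :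
    J.noncommProd cre hc (basisVec n) =
      (∏ j ∈ J, (√((n j : ℝ) + 1) : ℂ)) • basisVec (n + indOcc J) := by
  induction J using Finset.induction_on with
  | empty => simp [Finset.noncommProd_empty, indOcc]
  | insert a J ha ih =>
    have h1 : (n + indOcc J) a = n a := by simp [indOcc_apply, ha]
    have h2 : n + indOcc J + Finsupp.single a 1 = n + indOcc (insert a J) := by
      rw [add_assoc, indOcc, indOcc, Finset.sum_insert ha, add_comm (Finsupp.single a 1)]
    rw [Finset.noncommProd_insert_of_notMem _ _ _ _ ha, Module.End.mul_apply, ih _, map_smul,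
      cre_basisVec, h1, h2, smul_smul, Finset.prod_insert ha, mul_comm]

/-- The coefficient of `A(I,J)` on `e_n`, for disjoint `I` and `J`. -/
noncomputable def amp (I J : Finset (Site d)) (n : Occ d) : ℝ :=
  (∏ i ∈ I, √(n i)) * ∏ j ∈ J, √((n j : ℝ) + 1)

theorem opA_basisVec {I J : Finset (Site d)} (hIJ : Disjoint I J) (n : Occ d) :
    opA I J (basisVec n) = (amp I J n : ℂ) • basisVec (n + indOcc J - indOcc I) := by
  have h : ∏ i ∈ I, (√((n + indOcc J : Occ d) i) : ℂ) = ∏ i ∈ I, (√(n i) : ℂ) :=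
    Finset.prod_congr rfl fun i hi => by simp [indOcc_apply, Finset.disjoint_left.1 hIJ hi]
  have hcI : (I : Set (Site d)).Pairwise (Function.onFun Commute ann) :=
    fun i _ j _ _ => ann_commute i j
  have hcJ : (J : Set (Site d)).Pairwise (Function.onFun Commute cre) :=
    fun i _ j _ _ => cre_commute i j
  have hop : opA I J = I.noncommProd ann hcI * J.noncommProd cre hcJ := rfl
  rw [hop, Module.End.mul_apply, noncommProd_cre_basisVec, map_smul, noncommProd_ann_basisVec,
    smul_smul, h, amp, Complex.ofReal_mul, Complex.ofReal_prod, Complex.ofReal_prod, mul_comm]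

/-- The net number of particles that `A(I,J)` moves into `Λ`. -/
noncomputable def flux (I J Λ : Finset (Site d)) : ℤ :=
  ∑ l ∈ Λ, ((indOcc J l : ℤ) - indOcc I l)

theorem sum_indOcc (I Λ : Finset (Site d)) : ∑ l ∈ Λ, (indOcc I l : ℤ) = (Λ ∩ I).card := by
  simp [indOcc_apply]

theorem flux_eq (I J Λ : Finset (Site d)) : flux I J Λ = (Λ ∩ J).card - (Λ ∩ I).card := by
  rw [flux, Finset.sum_sub_distrib, sum_indOcc, sum_indOcc]

theorem flux_eq_zero_of_subset {I J Λ : Finset (Site d)} (hcard : I.card = J.card) (hI : I ⊆ Λ)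
    (hJ : J ⊆ Λ) : flux I J Λ = 0 := by
  rw [flux_eq, Finset.inter_eq_right.2 hI, Finset.inter_eq_right.2 hJ, hcard, sub_self]

theorem flux_eq_zero_of_disjoint {I J Λ : Finset (Site d)} (hI : Disjoint Λ I)
    (hJ : Disjoint Λ J) : flux I J Λ = 0 := by
  simp [flux_eq, Finset.disjoint_iff_inter_eq_empty.1 hI, Finset.disjoint_iff_inter_eq_empty.1 hJ]

theorem sq_flux_le {I J Λ : Finset (Site d)} (hcard : I.card = J.card) :
    (flux I J Λ : ℝ) ^ 2 ≤ (I.card : ℝ) ^ 2 := by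
  have h1 : (Λ ∩ J).card ≤ J.card := Finset.card_le_card Finset.inter_subset_right
  have h2 : (Λ ∩ I).card ≤ I.card := Finset.card_le_card Finset.inter_subset_right
  have h3 : |flux I J Λ| ≤ I.card := by
    rw [flux_eq, abs_le]
    omega
  rw [sq_le_sq, Nat.abs_cast]
  exact_mod_cast h3

theorem sum_occ_of_amp_ne_zero {I J : Finset (Site d)} {n : Occ d} (h : amp I J n ≠ 0)
    (Λ : Finset (Site d)) :
    ∑ l ∈ Λ, ((n + indOcc J - indOcc I : Occ d) l : ℤ) = ∑ l ∈ Λ, (n l : ℤ) + flux I J Λ := by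
  rw [flux, ← Finset.sum_add_distrib]
  refine Finset.sum_congr rfl fun l _ => ?_
  have h1 : indOcc I l ≤ n l := by
    rw [indOcc_apply]
    split_ifs with hl
    · by_contra hc
      have h0 : n l = 0 := by omega
      exact h (mul_eq_zero_of_left (Finset.prod_eq_zero hl (by simp [h0])) _)
    · exact Nat.zero_le _
  rw [Finsupp.tsub_apply, Finsupp.add_apply]
  omega

theorem gibbsWeight_eq_of_sum_eq {Λ : Finset (Site d)} {m n : Occ d}
    (h : ∑ l ∈ Λ, (m l : ℤ) = ∑ l ∈ Λ, (n l : ℤ)) : gibbsWeight β Λ m = gibbsWeight β Λ n := by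
  have h' : ∑ l ∈ Λ, (m l : ℝ) = ∑ l ∈ Λ, (n l : ℝ) := by exact_mod_cast h
  rw [gibbsWeight, gibbsWeight, Finset.prod_div_distrib, Finset.prod_div_distrib, ← Real.exp_sum,
    ← Real.exp_sum, ← Finset.mul_sum, ← Finset.mul_sum, h']

/-- `A(I,J)` conserves the number of particles in `Λ ⊇ I ∪ J`, hence the Gibbs weight. -/
theorem gibbsWeight_of_amp_ne_zero {I J Λ : Finset (Site d)} (hcard : I.card = J.card)
    (hI : I ⊆ Λ) (hJ : J ⊆ Λ) {n : Occ d} (h : amp I J n ≠ 0) :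
    gibbsWeight β Λ (n + indOcc J - indOcc I) = gibbsWeight β Λ n := by
  apply gibbsWeight_eq_of_sum_eq
  rw [sum_occ_of_amp_ne_zero h, flux_eq_zero_of_subset hcard hI hJ, add_zero]

theorem modular_opA (hβ : 0 < β) {I J Λ : Finset (Site d)} (hIJ : Disjoint I J)
    (hcard : I.card = J.card) (t : ℂ) (hI : I ⊆ Λ) (hJ : J ⊆ Λ) :
    modular β Λ t (opA I J) = opA I J := by
  apply op_ext
  intro n
  rw [modular, Module.End.mul_apply, Module.End.mul_apply, rhoPow_basisVec, map_smul,
    opA_basisVec hIJ, map_smul, map_smul, rhoPow_basisVec, smul_smul, smul_smul]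
  by_cases h : amp I J n = 0
  · simp [h]
  · have hw : (gibbsWeight β Λ n : ℂ) ≠ 0 := by exact_mod_cast (gibbsWeight_pos hβ Λ n).ne'
    have hp : (gibbsWeight β Λ n : ℂ) ^ (Complex.I * t) ≠ 0 := by
      simp [Complex.cpow_eq_zero_iff, hw]
    rw [gibbsWeight_of_amp_ne_zero hcard hI hJ h, Complex.cpow_neg]
    congr 1
    field_simp

theorem opA_mem (S : Subalgebra ℂ (Op d)) {I J : Finset (Site d)} (hI : ∀ i ∈ I, ann i ∈ S)
    (hJ : ∀ j ∈ J, cre j ∈ S) : opA I J ∈ S :=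
  S.mul_mem (S.toSubmonoid.noncommProd_mem I _ _ hI) (S.toSubmonoid.noncommProd_mem J _ _ hJ)

theorem opA_mem_polyAlg (I J : Finset (Site d)) : opA I J ∈ polyAlg d :=
  opA_mem _ (fun i _ => Algebra.subset_adjoin (Or.inl ⟨i, rfl⟩))
    fun j _ => Algebra.subset_adjoin (Or.inr ⟨j, rfl⟩)

theorem opA_mem_localAlg (I J : Finset (Site d)) : opA I J ∈ localAlg (I ∪ J) :=
  opA_mem _ (fun i hi => localAlg_mono (by simp [hi]) (ann_mem_localAlg i))
    fun j hj => localAlg_mono (by simp [hj]) (cre_mem_localAlg j)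

/-- Subtraction of operators in terms of the `ℂ`-algebra operations, for which subalgebras of
`Op d` have closure lemmas. -/
theorem op_sub_eq (f g : Op d) : f - g = f + (-1 : ℂ) • g :=
  op_ext fun n => by
    rw [LinearMap.sub_apply, LinearMap.add_apply, LinearMap.smul_apply, neg_one_smul,
      sub_eq_add_neg]

theorem op_sub_mem (S : Subalgebra ℂ (Op d)) {f g : Op d} (hf : f ∈ S) (hg : g ∈ S) :
    f - g ∈ S := by
  rw [op_sub_eq]
  exact add_mem hf (S.smul_mem hg _)

theorem innerDer_mem_polyAlg {X f : Op d} (hX : X ∈ polyAlg d) (hf : f ∈ polyAlg d) :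
    innerDer X f ∈ polyAlg d :=
  Subalgebra.smul_mem _ (op_sub_mem _ (mul_mem hX hf) (mul_mem hf hX)) _

theorem innerDer_opA_eq_zero {I J Λ : Finset (Site d)} {f : Op d} (hf : f ∈ localAlg Λ)
    (hI : Disjoint I Λ) (hJ : Disjoint J Λ) : innerDer (opA I J) f = 0 := by
  have h := mem_localAlg_iff.1 hf
  have hc : opA I J ∈ Subalgebra.centralizer ℂ {f} := by
    refine opA_mem _ (fun i hi => ?_) fun j hj => ?_
    · simpa [Subalgebra.mem_centralizer_iff] using (h.1 i (Finset.disjoint_left.1 hI hi)).eq.symm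
    · simpa [Subalgebra.mem_centralizer_iff] using (h.2.1 j (Finset.disjoint_left.1 hJ hj)).eq.symm
  rw [innerDer, (Subalgebra.mem_centralizer_iff ℂ).1 hc f rfl]
  exact op_ext fun n => by
    rw [LinearMap.smul_apply, LinearMap.sub_apply, sub_self, smul_zero, LinearMap.zero_apply]

theorem normSq_smul (hβ : 0 < β) {Λ : Finset (Site d)} {f : Op d} (hf : f ∈ localAlg Λ) (c : ℂ) :
    normSq β (c • f) = ENNReal.ofReal (‖c‖ ^ 2) * normSq β f := by
  rw [normSq_eq_localNormSq hβ hf, normSq_eq_localNormSq hβ (Subalgebra.smul_mem _ hf c),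
    localNormSq_eq hβ, localNormSq_eq hβ, ← ENNReal.tsum_mul_left]
  refine tsum_congr fun m => ?_
  rw [← ENNReal.tsum_mul_left]
  refine tsum_congr fun n => ?_
  rw [← ENNReal.ofReal_mul (sq_nonneg _)]
  have : matElem (c • f) m.1 n.1 = c * matElem f m.1 n.1 := rfl
  rw [this, norm_mul]
  congr 1
  ring

theorem normSq_zero (hβ : 0 < β) : normSq β (0 : Op d) = 0 := by
  simpa using normSq_smul hβ (zero_mem (localAlg (∅ : Finset (Site d)))) 0

theorem mem_shift {I : Finset (Site d)} {k l : Site d} : l ∈ shift I k ↔ ∃ i ∈ I, i + k = l := by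
  simp [shift]

/-- Only finitely many translates of `A(I,J)` fail to commute with a local operator. -/
theorem dirichletForm_lt_top (hβ : 0 < β) (I J : Finset (Site d)) {f : Op d}
    (hf : f ∈ polyAlg d) : dirichletForm β I J f < ⊤ := by
  obtain ⟨Λ, hl⟩ := exists_mem_localAlg hf
  have hd : ∀ K ⊆ I ∪ J, ∀ k ∉ (Λ ×ˢ (I ∪ J)).image (fun p => p.1 - p.2),
      Disjoint (shift K k) Λ := by
    intro K hK k hk
    refine Finset.disjoint_left.2 fun l hlK hlΛ => hk ?_
    obtain ⟨i, hi, rfl⟩ := mem_shift.1 hlK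
    exact Finset.mem_image.2 ⟨(i + k, i), Finset.mem_product.2 ⟨hlΛ, hK hi⟩, by simp⟩
  rw [dirichletForm, tsum_eq_sum (s := (Λ ×ˢ (I ∪ J)).image (fun p => p.1 - p.2))]
  · exact ENNReal.sum_lt_top.2 fun k _ =>
      normSq_lt_top hβ (innerDer_mem_polyAlg (opA_mem_polyAlg _ _) hf)
  · intro k hk
    rw [innerDer_opA_eq_zero hl (hd I Finset.subset_union_left k hk)
      (hd J Finset.subset_union_right k hk), normSq_zero hβ]

/-! ### One-site moments -/

/-- The mean occupation number of a site. -/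
noncomputable def meanOcc (β : ℝ) : ℝ := ∑' k : ℕ, siteWeight β k * k

/-- The variance of the occupation number of a site. -/
noncomputable def varOcc (β : ℝ) : ℝ := ∑' k : ℕ, siteWeight β k * (k - meanOcc β) ^ 2

theorem hasSum_meanOcc (hβ : 0 < β) :
    HasSum (fun k : ℕ => siteWeight β k * k) (meanOcc β) :=
  Summable.hasSum ((summable_pow_mul_siteWeight hβ 1).congr fun k => by ring)

theorem hasSum_centered (hβ : 0 < β) :
    HasSum (fun k : ℕ => siteWeight β k * (k - meanOcc β)) 0 := by
  have h := (hasSum_meanOcc hβ).sub ((hasSum_siteWeight hβ).mul_right (meanOcc β))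
  rw [one_mul, sub_self] at h
  simpa only [mul_sub] using h

theorem hasSum_varOcc (hβ : 0 < β) :
    HasSum (fun k : ℕ => siteWeight β k * (k - meanOcc β) ^ 2) (varOcc β) := by
  refine Summable.hasSum (((summable_pow_mul_siteWeight hβ 2).add
    (((hasSum_meanOcc hβ).summable.mul_left (-2 * meanOcc β)).add
      ((hasSum_siteWeight hβ).summable.mul_left (meanOcc β ^ 2)))).congr fun k => by ring)

theorem varOcc_pos (hβ : 0 < β) : 0 < varOcc β := by
  have hnn : ∀ k : ℕ, 0 ≤ siteWeight β k * (k - meanOcc β) ^ 2 := fun k =>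
    mul_nonneg (siteWeight_pos hβ k).le (sq_nonneg _)
  -- At least one of `k = 0`, `k = 1` differs from the mean.
  by_cases h : meanOcc β = 0
  · refine (hasSum_varOcc hβ).summable.tsum_pos hnn 1 ?_
    simpa [h] using siteWeight_pos hβ 1
  · refine (hasSum_varOcc hβ).summable.tsum_pos hnn 0 (mul_pos (siteWeight_pos hβ 0) ?_)
    simpa using sq_pos_of_ne_zero h

theorem meanOcc_nonneg (hβ : 0 < β) : 0 ≤ meanOcc β :=
  tsum_nonneg fun k => mul_nonneg (siteWeight_pos hβ k).le k.cast_nonneg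

theorem hasSum_gibbsWeight_mul_prod (Λ : Finset (Site d)) (h : Site d → ℕ → ℝ)
    (hs : ∀ j ∈ Λ, Summable fun k => siteWeight β k * h j k) :
    HasSum (fun n : LocalOcc Λ => gibbsWeight β Λ n.1 * ∏ j ∈ Λ, h j (n.1 j))
      (∏ j ∈ Λ, ∑' k, siteWeight β k * h j k) := by
  have := hasSum_localOcc_prod Λ (fun j k => siteWeight β k * h j k) hs
  simpa only [Finset.prod_mul_distrib, ← gibbsWeight_eq] using this

/-- A bound on `‖A(I,J)‖²_{2,ω₀}` that is the same for all translates: `A(I,J)` conserves the weight,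
so the norm is the expectation of the product of the `n_i` (`i ∈ I`) and the `n_j + 1` (`j ∈ J`). -/
theorem normSq_opA_le (hβ : 0 < β) {I J : Finset (Site d)} (hIJ : Disjoint I J)
    (hcard : I.card = J.card) :
    normSq β (opA I J) ≤ ENNReal.ofReal (meanOcc β ^ I.card * (meanOcc β + 1) ^ J.card) := by
  have hs1 := hasSum_meanOcc hβ
  have hs2 : HasSum (fun k : ℕ => siteWeight β k * (k + 1)) (meanOcc β + 1) := by
    simpa only [mul_add, mul_one] using hs1.add (hasSum_siteWeight hβ)
  have hJI : ∀ j ∈ J, j ∉ I := fun j hj => Finset.disjoint_right.1 hIJ hj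
  have hsum : HasSum (fun n : LocalOcc (I ∪ J) => gibbsWeight β (I ∪ J) n.1 * amp I J n.1 ^ 2)
      (meanOcc β ^ I.card * (meanOcc β + 1) ^ J.card) := by
    have h := hasSum_gibbsWeight_mul_prod (β := β) (I ∪ J)
      (fun l k => if l ∈ I then (k : ℝ) else k + 1) (fun l _ => by
        by_cases hl : l ∈ I
        · simpa only [hl, if_true] using hs1.summable
        · simpa only [hl, if_false] using hs2.summable)
    have h1 : ∏ l ∈ I ∪ J, ∑' k, siteWeight β k * (if l ∈ I then (k : ℝ) else k + 1) =
        meanOcc β ^ I.card * (meanOcc β + 1) ^ J.card := by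
      rw [Finset.prod_union hIJ, ← Finset.prod_const, ← Finset.prod_const]
      congr 1 <;> refine Finset.prod_congr rfl fun l hl => ?_
      · simp only [hl, if_true]
        exact hs1.tsum_eq
      · simp only [hJI l hl, if_false]
        exact hs2.tsum_eq
    rw [h1] at h
    refine (congrArg (fun F => HasSum F _) (funext fun n => ?_)).mpr h
    rw [amp, mul_pow, ← Finset.prod_pow, ← Finset.prod_pow, Finset.prod_union hIJ]
    congr 2 <;> refine Finset.prod_congr rfl fun l hl => ?_
    · rw [if_pos hl, Real.sq_sqrt (Nat.cast_nonneg _)]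
    · rw [if_neg (hJI l hl), Real.sq_sqrt (by positivity)]
  have hnn : ∀ n : LocalOcc (I ∪ J), 0 ≤ gibbsWeight β (I ∪ J) n.1 * amp I J n.1 ^ 2 := fun n =>
    mul_nonneg (gibbsWeight_pos hβ _ _).le (sq_nonneg _)
  rw [normSq_eq_localNormSq hβ (opA_mem_localAlg I J), localNormSq_eq hβ, ENNReal.tsum_comm,
    ← hsum.tsum_eq, ENNReal.ofReal_tsum_of_nonneg hnn hsum.summable]
  refine ENNReal.tsum_le_tsum fun n => ?_
  have hmat : ∀ m : Occ d, matElem (opA I J) m n.1 =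
      if n.1 + indOcc J - indOcc I = m then (amp I J n.1 : ℂ) else 0 := by
    intro m
    rw [matElem, opA_basisVec hIJ, Finsupp.smul_apply, basisVec, Finsupp.single_apply]
    split_ifs <;> simp
  by_cases ha : amp I J n.1 = 0
  · simp [hmat, ha]
  have hmem : (n.1 + indOcc J - indOcc I).support ⊆ I ∪ J := by
    intro l hl
    by_contra hc
    have h1 : l ∉ J := fun h => hc (Finset.mem_union_right _ h)
    simp [n.apply_eq_zero hc, indOcc_apply, h1] at hl
  rw [tsum_eq_single (⟨_, hmem⟩ : LocalOcc (I ∪ J))]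
  · rw [hmat, if_pos rfl, gibbsWeight_of_amp_ne_zero hcard Finset.subset_union_left
      Finset.subset_union_right ha, Real.mul_self_sqrt (gibbsWeight_pos hβ _ _).le,
      Complex.norm_real, Real.norm_eq_abs, sq_abs]
  · intro m hm
    rw [hmat, if_neg fun h => hm (Subtype.ext h.symm)]
    simp

/-! ### The centered particle number of a finite region -/

/-- The centered particle number `∑_{j ∈ Λ} (N_j - ω₀(N_j))`. -/
noncomputable def centeredNumber (β : ℝ) (Λ : Finset (Site d)) : Op d :=
  ∑ j ∈ Λ, (number j - algebraMap ℂ (Op d) (meanOcc β : ℂ))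

theorem centeredNumber_basisVec (Λ : Finset (Site d)) (n : Occ d) :
    centeredNumber β Λ (basisVec n) =
      ((∑ j ∈ Λ, ((n j : ℝ) - meanOcc β) : ℝ) : ℂ) • basisVec n := by
  rw [centeredNumber, LinearMap.sum_apply, Complex.ofReal_sum, Finset.sum_smul]
  refine Finset.sum_congr rfl fun j _ => ?_
  rw [LinearMap.sub_apply, number_basisVec, Module.algebraMap_end_apply, ← sub_smul]
  push_cast
  rfl

theorem centeredNumber_mem (S : Subalgebra ℂ (Op d)) {Λ : Finset (Site d)}
    (h : ∀ j ∈ Λ, number j ∈ S) : centeredNumber β Λ ∈ S :=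
  sum_mem fun j hj => op_sub_mem S (h j hj) (S.algebraMap_mem _)

theorem centeredNumber_mem_polyAlg (Λ : Finset (Site d)) : centeredNumber β Λ ∈ polyAlg d :=
  centeredNumber_mem _ fun j _ => mul_mem (Algebra.subset_adjoin (Or.inr ⟨j, rfl⟩))
    (Algebra.subset_adjoin (Or.inl ⟨j, rfl⟩))

theorem centeredNumber_mem_localAlg (Λ : Finset (Site d)) : centeredNumber β Λ ∈ localAlg Λ :=
  centeredNumber_mem _ fun j hj => localAlg_mono (by simpa using hj)
    (mul_mem (cre_mem_localAlg j) (ann_mem_localAlg j))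

theorem matElem_centeredNumber (Λ : Finset (Site d)) (m n : Occ d) :
    matElem (centeredNumber β Λ) m n =
      if m = n then ((∑ j ∈ Λ, ((n j : ℝ) - meanOcc β) : ℝ) : ℂ) else 0 := by
  rw [matElem, centeredNumber_basisVec, Finsupp.smul_apply, basisVec, Finsupp.single_apply]
  by_cases h : m = n
  · simp [h]
  · simp [h, Ne.symm h]

theorem hasSum_gibbsWeight_mul_centered (hβ : 0 < β) {Λ : Finset (Site d)} {j : Site d}
    (hj : j ∈ Λ) :
    HasSum (fun n : LocalOcc Λ => gibbsWeight β Λ n.1 * ((n.1 j : ℝ) - meanOcc β)) 0 := by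
  have h := hasSum_gibbsWeight_mul_prod (β := β) Λ
    (fun i k => if i = j then (k : ℝ) - meanOcc β else 1) (fun i _ => by
      by_cases hi : i = j
      · simpa only [hi, if_true] using (hasSum_centered hβ).summable
      · simpa only [hi, if_false, mul_one] using (hasSum_siteWeight hβ).summable)
  rw [Finset.prod_eq_zero hj (by simpa only [if_true] using (hasSum_centered hβ).tsum_eq)] at h
  simpa only [Finset.prod_ite_eq' Λ j, hj, if_true] using h

theorem hasSum_gibbsWeight_mul_centered_mul (hβ : 0 < β) {Λ : Finset (Site d)} {j l : Site d}
    (hj : j ∈ Λ) (hl : l ∈ Λ) :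
    HasSum (fun n : LocalOcc Λ => gibbsWeight β Λ n.1 *
      (((n.1 j : ℝ) - meanOcc β) * ((n.1 l : ℝ) - meanOcc β)))
      (if j = l then varOcc β else 0) := by
  -- The two indicator factors at site `i` have mean `varOcc β` if `i = j = l`, mean `0` if exactly
  -- one of `i = j`, `i = l` holds, and mean `1` otherwise.
  have hterm : ∀ i, HasSum (fun k : ℕ => siteWeight β k *
      ((if i = j then (k : ℝ) - meanOcc β else 1) * (if i = l then (k : ℝ) - meanOcc β else 1)))
      (if i = j then (if i = l then varOcc β else 0) else (if i = l then 0 else 1)) := by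
    intro i
    split_ifs
    · simpa only [sq] using hasSum_varOcc hβ
    · simpa only [mul_one] using hasSum_centered hβ
    · simpa only [one_mul] using hasSum_centered hβ
    · simpa only [mul_one] using hasSum_siteWeight hβ
  have h := hasSum_gibbsWeight_mul_prod (β := β) Λ
    (fun i k => (if i = j then (k : ℝ) - meanOcc β else 1) *
      (if i = l then (k : ℝ) - meanOcc β else 1)) fun i _ => (hterm i).summable
  have hval : ∏ i ∈ Λ, ∑' k : ℕ, siteWeight β k *
      ((if i = j then (k : ℝ) - meanOcc β else 1) * (if i = l then (k : ℝ) - meanOcc β else 1)) =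
      if j = l then varOcc β else 0 := by
    simp only [fun i => (hterm i).tsum_eq]
    by_cases hjl : j = l
    · subst hjl
      rw [if_pos rfl, Finset.prod_eq_single_of_mem j hj fun i _ hi => by simp [hi]]
      simp
    · rw [if_neg hjl]
      exact Finset.prod_eq_zero hj (by simp [hjl])
  rw [hval] at h
  simpa only [Finset.prod_mul_distrib, Finset.prod_ite_eq' Λ, hj, hl, if_true] using h

theorem omega0_centeredNumber (hβ : 0 < β) (Λ : Finset (Site d)) :
    omega0 β (centeredNumber β Λ) = 0 := by
  have h : HasSum (fun n : LocalOcc Λ =>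
      gibbsWeight β Λ n.1 * ∑ j ∈ Λ, ((n.1 j : ℝ) - meanOcc β)) 0 := by
    simpa only [Finset.mul_sum, Finset.sum_const_zero] using
      hasSum_sum fun j hj => hasSum_gibbsWeight_mul_centered hβ (Λ := Λ) (j := j) hj
  rw [omega0_eq_localExp hβ (centeredNumber_mem_polyAlg Λ) (centeredNumber_mem_localAlg Λ),
    localExp]
  simp only [matElem_rhoPow_mul, matElem_centeredNumber, if_true, ← Complex.ofReal_mul]
  rw [← Complex.ofReal_tsum, h.tsum_eq, Complex.ofReal_zero]

/-- By independence the variance of the particle number of `Λ` is extensive. -/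
theorem normSq_centeredNumber (hβ : 0 < β) (Λ : Finset (Site d)) :
    normSq β (centeredNumber β Λ) = ENNReal.ofReal (Λ.card * varOcc β) := by
  have h : HasSum (fun n : LocalOcc Λ =>
      gibbsWeight β Λ n.1 * (∑ j ∈ Λ, ((n.1 j : ℝ) - meanOcc β)) ^ 2) (Λ.card * varOcc β) := by
    have h1 := hasSum_sum fun j hj => hasSum_sum fun l hl =>
      hasSum_gibbsWeight_mul_centered_mul hβ (Λ := Λ) (j := j) (l := l) hj hl
    have h2 : ∑ j ∈ Λ, ∑ l ∈ Λ, (if j = l then varOcc β else 0) = Λ.card * varOcc β := by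
      simp
    rw [h2] at h1
    refine (congrArg (fun F => HasSum F _) (funext fun n => ?_)).mpr h1
    rw [sq, Finset.sum_mul_sum, Finset.mul_sum]
    exact Finset.sum_congr rfl fun j _ => Finset.mul_sum _ _ _
  rw [normSq_eq_localNormSq hβ (centeredNumber_mem_localAlg Λ), localNormSq_eq hβ, ← h.tsum_eq,
    ENNReal.ofReal_tsum_of_nonneg (fun n => mul_nonneg (gibbsWeight_pos hβ _ _).le (sq_nonneg _))
      h.summable]
  refine tsum_congr fun m => ?_
  rw [tsum_eq_single m]
  · rw [matElem_centeredNumber, if_pos rfl, Real.mul_self_sqrt (gibbsWeight_pos hβ _ _).le,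
      Complex.norm_real, Real.norm_eq_abs, sq_abs]
  · intro n hn
    rw [matElem_centeredNumber, if_neg fun h => hn (Subtype.ext h.symm)]
    simp

theorem innerDer_opA_centeredNumber {I J : Finset (Site d)} (hIJ : Disjoint I J)
    (Λ : Finset (Site d)) :
    innerDer (opA I J) (centeredNumber β Λ) = (-(Complex.I * flux I J Λ)) • opA I J := by
  apply op_ext
  intro n
  rw [innerDer, LinearMap.smul_apply, LinearMap.smul_apply, LinearMap.sub_apply,
    Module.End.mul_apply, Module.End.mul_apply, centeredNumber_basisVec, map_smul,
    opA_basisVec hIJ, map_smul, centeredNumber_basisVec]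
  by_cases h : amp I J n = 0
  · simp [h]
  · have h1 : (∑ j ∈ Λ, (((n + indOcc J - indOcc I : Occ d) j : ℝ) - meanOcc β)) =
        ∑ j ∈ Λ, ((n j : ℝ) - meanOcc β) + flux I J Λ := by
      have := congrArg (Int.cast (R := ℝ)) (sum_occ_of_amp_ne_zero h Λ)
      simp only [Int.cast_add, Int.cast_sum, Int.cast_natCast] at this
      rw [Finset.sum_sub_distrib, Finset.sum_sub_distrib, this]
      ring
    rw [h1, smul_smul, smul_smul, smul_smul, ← sub_smul, smul_smul]
    congr 1
    push_cast
    ring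

theorem normSq_innerDer_centeredNumber_le (hβ : 0 < β) {I J : Finset (Site d)}
    (hIJ : Disjoint I J) (hcard : I.card = J.card) (Λ : Finset (Site d)) :
    normSq β (innerDer (opA I J) (centeredNumber β Λ)) ≤ ENNReal.ofReal
      ((flux I J Λ : ℝ) ^ 2 * (meanOcc β ^ I.card * (meanOcc β + 1) ^ J.card)) := by
  have hn : ‖-(Complex.I * (flux I J Λ : ℂ))‖ ^ 2 = (flux I J Λ : ℝ) ^ 2 := by
    rw [norm_neg, norm_mul, Complex.norm_I, one_mul, Complex.norm_intCast, sq_abs]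
  rw [innerDer_opA_centeredNumber hIJ, normSq_smul hβ (opA_mem_localAlg I J), hn,
    ENNReal.ofReal_mul (sq_nonneg _)]
  gcongr
  exact normSq_opA_le hβ hIJ hcard

/-! ### Boxes and failure of the Poincaré inequality -/

/-- The box `[-L, L]^d`. -/
noncomputable def box (d L : ℕ) : Finset (Site d) := Finset.Icc (fun _ => -(L : ℤ)) fun _ => (L : ℤ)

theorem mem_box {L : ℕ} {k : Site d} : k ∈ box d L ↔ ∀ a, (k a).natAbs ≤ L := by
  simp only [box, Finset.mem_Icc, Pi.le_def, ← forall_and]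
  exact forall_congr' fun a => by omega

theorem card_box (d L : ℕ) : (box d L).card = (2 * L + 1) ^ d := by
  have : ((L : ℤ) + 1 + (L : ℤ)).toNat = 2 * L + 1 := by omega
  simp [box, Pi.card_Icc, this]

theorem exists_subset_box (I : Finset (Site d)) : ∃ R, I ⊆ box d R :=
  ⟨I.sup fun i => Finset.univ.sup fun a => (i a).natAbs, fun i hi => mem_box.2 fun a =>
    (Finset.le_sup (f := fun a => (i a).natAbs) (Finset.mem_univ a)).trans
      (Finset.le_sup (f := fun i : Site d => Finset.univ.sup fun a => (i a).natAbs) hi)⟩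

theorem shift_subset_box {I : Finset (Site d)} {R M : ℕ} (hI : I ⊆ box d R) {k : Site d}
    (hk : k ∈ box d M) : shift I k ⊆ box d (R + M) := by
  intro l hl
  obtain ⟨i, hi, rfl⟩ := mem_shift.1 hl
  refine mem_box.2 fun a => ?_
  have h1 := mem_box.1 (hI hi) a
  have h2 := mem_box.1 hk a
  rw [Pi.add_apply]
  omega

theorem disjoint_box_shift {I : Finset (Site d)} {R M : ℕ} (hI : I ⊆ box d R) {k : Site d}
    (hk : k ∉ box d (R + M)) : Disjoint (box d M) (shift I k) := by
  refine Finset.disjoint_right.2 fun l hl hlM => hk ?_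
  obtain ⟨i, hi, rfl⟩ := mem_shift.1 hl
  refine mem_box.2 fun a => ?_
  have h1 := mem_box.1 (hI hi) a
  have h2 := mem_box.1 hlM a
  rw [Pi.add_apply] at h2
  omega

/-- For the particle number of a box only translates of `A(I,J)` near the boundary contribute. -/
theorem dirichletForm_centeredNumber_box_le (hβ : 0 < β) {I J : Finset (Site d)}
    (hIJ : Disjoint I J) (hcard : I.card = J.card) {R : ℕ} (hI : I ⊆ box d R) (hJ : J ⊆ box d R)
    (M : ℕ) :
    dirichletForm β I J (centeredNumber β (box d (R + M))) ≤ ENNReal.ofReal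
      (((2 * (2 * R + M : ℝ) + 1) ^ d - (2 * (M : ℝ) + 1) ^ d) *
        (I.card ^ 2 * (meanOcc β ^ I.card * (meanOcc β + 1) ^ J.card))) := by
  have hν := meanOcc_nonneg hβ
  have hIJk : ∀ k, Disjoint (shift I k) (shift J k) := fun k => (Finset.disjoint_map _).2 hIJ
  have hIk : ∀ k, (shift I k).card = I.card := fun k => Finset.card_map _
  have hJk : ∀ k, (shift J k).card = J.card := fun k => Finset.card_map _
  have hck : ∀ k, (shift I k).card = (shift J k).card := fun k => by rw [hIk, hJk, hcard]
  have hb := fun k => normSq_innerDer_centeredNumber_le hβ (hIJk k) (hck k) (box d (R + M))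
  have hsub : box d M ⊆ box d (R + (R + M)) := fun k hk => mem_box.2 fun a =>
    (mem_box.1 hk a).trans (by omega)
  rw [dirichletForm, tsum_eq_sum (s := box d (R + (R + M)) \ box d M)]
  · have hcardR : ((box d (R + (R + M)) \ box d M).card : ℝ) =
        (2 * (2 * R + M : ℝ) + 1) ^ d - (2 * (M : ℝ) + 1) ^ d := by
      rw [Finset.card_sdiff_of_subset hsub, Nat.cast_sub (Finset.card_le_card hsub), card_box,
        card_box]
      push_cast
      ring
    rw [← hcardR, ENNReal.ofReal_mul (Nat.cast_nonneg _), ENNReal.ofReal_natCast, ← nsmul_eq_mul]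
    refine Finset.sum_le_card_nsmul _ _ _ fun k _ => (hb k).trans (ENNReal.ofReal_le_ofReal ?_)
    have := sq_flux_le (Λ := box d (R + M)) (hck k)
    rw [hIk] at this
    rw [hIk, hJk]
    exact (mul_le_mul_of_nonneg_right this (by positivity))
  · intro k hk
    have hz : flux (shift I k) (shift J k) (box d (R + M)) = 0 := by
      -- The translates by `k` lie inside the box or outside of it: no particles cross its boundary.
      by_cases hkM : k ∈ box d M
      · exact flux_eq_zero_of_subset (hck k) (shift_subset_box hI hkM) (shift_subset_box hJ hkM)
      · have hk' : k ∉ box d (R + (R + M)) := fun h => hk (Finset.mem_sdiff.2 ⟨h, hkM⟩)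
        exact flux_eq_zero_of_disjoint (disjoint_box_shift hI hk') (disjoint_box_shift hJ hk')
    have := hb k
    rw [hz] at this
    simpa using this

theorem tendsto_boxSide_ratio (a b : ℝ) :
    Tendsto (fun M : ℕ => (2 * (a + M) + 1) / (2 * (b + M) + 1)) atTop (𝓝 1) := by
  have h1 : Tendsto (fun M : ℕ => 2 * (b + (M : ℝ)) + 1) atTop atTop :=
    tendsto_atTop_add_const_right _ _ ((tendsto_atTop_add_const_left _ _
      tendsto_natCast_atTop_atTop).const_mul_atTop two_pos)
  have h2 : Tendsto (fun M : ℕ => 1 + 2 * (a - b) / (2 * (b + (M : ℝ)) + 1)) atTop (𝓝 1) := by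
    simpa using (h1.const_div_atTop (2 * (a - b))).const_add 1
  refine h2.congr' ?_
  filter_upwards [h1.eventually_gt_atTop 0] with M hM
  field_simp
  ring

theorem not_poincareInequality (hβ : 0 < β) {I J : Finset (Site d)} (hIJ : Disjoint I J)
    (hcard : I.card = J.card) : ¬ PoincareInequality β (dirichletForm β I J) := by
  rintro ⟨m, hm, hP⟩
  obtain ⟨R, hR⟩ := exists_subset_box (I ∪ J)
  have hν := meanOcc_nonneg hβ
  set K : ℝ := I.card ^ 2 * (meanOcc β ^ I.card * (meanOcc β + 1) ^ J.card)
  have hv := varOcc_pos hβ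
  -- The inequality for the particle number of `box d (R + M)`, divided by the volume of that box.
  have key : ∀ M : ℕ, m * varOcc β ≤ (((2 * ((2 * R : ℝ) + M) + 1) / (2 * ((R : ℝ) + M) + 1)) ^ d -
      ((2 * ((0 : ℝ) + M) + 1) / (2 * ((R : ℝ) + M) + 1)) ^ d) * K := by
    intro M
    have h := (hP _ (centeredNumber_mem_polyAlg (β := β) (box d (R + M)))).trans
      (dirichletForm_centeredNumber_box_le hβ hIJ hcard
        (Finset.subset_union_left.trans hR) (Finset.subset_union_right.trans hR) M)
    have hs : 0 < (2 * ((R : ℝ) + M) + 1) ^ d := by positivity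
    have hpow : (2 * (M : ℝ) + 1) ^ d ≤ (2 * (2 * R + M : ℝ) + 1) ^ d := by
      gcongr
      linarith [(Nat.cast_nonneg R : (0 : ℝ) ≤ R)]
    rw [omega0_centeredNumber hβ, map_zero, op_sub_eq, smul_zero, add_zero, normSq_centeredNumber hβ,
      ← ENNReal.ofReal_mul hm.le, ENNReal.ofReal_le_ofReal_iff
        (mul_nonneg (sub_nonneg.2 hpow) (by positivity)), card_box] at h
    push_cast at h
    rw [div_pow, div_pow, ← sub_div, div_mul_eq_mul_div, le_div_iff₀ hs, zero_add]
    linarith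
  have hlim : Tendsto (fun M : ℕ => (((2 * ((2 * R : ℝ) + M) + 1) / (2 * ((R : ℝ) + M) + 1)) ^ d -
      ((2 * ((0 : ℝ) + M) + 1) / (2 * ((R : ℝ) + M) + 1)) ^ d) * K) atTop (𝓝 0) := by
    simpa using (((tendsto_boxSide_ratio (2 * R) R).pow d).sub
      ((tendsto_boxSide_ratio 0 R).pow d)).mul_const K
  exact (mul_pos hm hv).not_ge (ge_of_tendsto' hlim key)

end LatticeBosons

/-- Failure of the Poincaré inequality for `ℰ_{I,J}`. The first three conjuncts record that the
objects involved are well defined on `𝒟`: the traces converge absolutely, the infinite volume limits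
exist, and the norm and the form are finite. The fourth is the invariance of `A(I,J)` under the
modular dynamics (the finite volume dynamics already fix it as soon as `Λ` contains `I` and `J`). -/
theorem mainTheorem2 (d : ℕ) (β : ℝ) (hβ : 0 < β)
    (I J : Finset (LatticeBosons.Site d)) (hIJ : Disjoint I J) (hcard : I.card = J.card) :
    (∀ f ∈ LatticeBosons.polyAlg d,
      (∀ Λ : Finset (LatticeBosons.Site d), Summable fun n : LatticeBosons.LocalOcc Λ =>
        LatticeBosons.matElem (LatticeBosons.rhoPow β Λ 1 * f) n n) ∧
      Tendsto (fun Λ => LatticeBosons.localExp β Λ f) atTop (𝓝 (LatticeBosons.omega0 β f))) ∧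
    (∀ f ∈ LatticeBosons.polyAlg d,
      Tendsto (fun Λ => LatticeBosons.localNormSq β Λ f) atTop (𝓝 (LatticeBosons.normSq β f)) ∧
      LatticeBosons.normSq β f < ⊤) ∧
    (∀ f ∈ LatticeBosons.polyAlg d, LatticeBosons.dirichletForm β I J f < ⊤) ∧
    (∀ (t : ℂ) (Λ : Finset (LatticeBosons.Site d)), I ⊆ Λ → J ⊆ Λ →
      LatticeBosons.modular β Λ t (LatticeBosons.opA I J) = LatticeBosons.opA I J) ∧
    ¬ LatticeBosons.PoincareInequality β (LatticeBosons.dirichletForm β I J) := by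
  open LatticeBosons in
  exact ⟨fun f hf => ⟨fun Λ => summable_trace hβ Λ hf, tendsto_localExp hβ hf⟩,
    fun f hf => ⟨tendsto_localNormSq hβ hf, normSq_lt_top hβ hf⟩,
    fun f hf => dirichletForm_lt_top hβ I J hf,
    fun t Λ hI hJ => modular_opA hβ hIJ hcard t hI hJ,
    not_poincareInequality hβ hIJ hcard⟩
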